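/- **Theorem 6.1 (guaranteed a posteriori error estimate).** Let $\Omega=(a,b)\subset\mathbb R$ with $a<b$, let $\beta\in\mathbb R\setminus\{0\}$ and $f\in L^2(\Omega)$. With the outward normal $n(a)=-1$, $n(b)=1$, let $\partial_\pm\Omega=\{p\in\{a,b\}:\pm\beta n(p)>0\}$ be the outflow and inflow boundary, and $H^1_+(\Omega)=\{v\in H^1(\Omega): v=0 \text{ on }\partial_+\Omega\}$. Write $(v,w)_D=\int_D vw$, $\|v\|_D=(v,v)_D^{1/2}$, and omit $D$ if $D=\Omega$. Let $\mathcal T_h$ be a mesh of $\Omega$ with vertices $a=x_0<x_1<\dots<x_n=b$, whose elements are the intervals $K=(x_{i},x_{i+1})$, of length $h_K$. For a vertex $\boldsymbol a$ let $\psi_{\boldsymbol a}$ be the continuous piecewise affine hat function with value $1$ at $\boldsymbol a$ and $0$ at all other vertices, $\mathcal T_{\boldsymbol a}$ the set of the (one or two) elements having $\boldsymbol a$ as an endpoint, and $\omega_{\boldsymbol a}$ the corresponding open interval (patch). Let $\mathcal P_{k}(\mathcal T)$ denote the functions that are polynomials of degree at most $k$ on each element of $\mathcal T$. Let $u\in L^2(\Omega)$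 be the ultra-weak solution of $\beta u'=f$ in $\Omega$, $u=0$ on $\partial_-\Omega$, that is, $$-(u,\beta v')=(f,v)\qquad\forall v\in H^1_+(\Omega).$$ Let $u_h\in L^2(\Omega)$ be any function with $$(f,\psi_{\boldsymbol a})+(u_h,\beta\psi_{\boldsymbol a}')=0\qquad\text{for all interior vertices and for the inflow vertex } \boldsymbol a .$$ Let $k'\ge 0$ be an integer. For every vertex $\boldsymbol a$ let $s_h^{\boldsymbol a}\in\mathcal P_{k'}(\mathcal T_{\boldsymbol a})\cap H^1(\omega_{\boldsymbol a})$ be the solution of $$\big(\beta(\psi_{\boldsymbol a}s_h^{\boldsymbol a})',v_h\big)_{\omega_{\boldsymbol a}}=\big(f\psi_{\boldsymbol a}+\beta\psi_{\boldsymbol a}'u_h,\,v_h\big)_{\omega_{\boldsymbol a}}\qquad\forall v_h\in\mathcal P_{k'}(\mathcal T_{\boldsymbol a}),$$ and let $s_h=\sum_{\boldsymbol a}\psi_{\boldsymbol a}s_h^{\boldsymbol a}$. Then $u$ and all the $s_h^{\boldsymbol a}$ exist and are unique (in $L^2(\Omega)$ and $L^2(\omega_{\boldsymbol a})$), and $$\|u-u_h\|\le\Big\{\sum_{K\in\mathcal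 T_h}\Big(\|u_h-s_h\|_K+\frac{h_K}{\pi|\beta|}\,\|(I-\Pi)f\|_K\Big)^2\Big\}^{1/2},$$ where $\Pi$ is the $L^2(\Omega)$-orthogonal projection onto $\mathcal P_{k'}(\mathcal T_h)$. -/

import Mathlib

open MeasureTheory Set

noncomputable section

namespace Advection1D

/-- The Lebesgue space `L²(D)` of an open set `D ⊆ ℝ`. -/
abbrev L2 (D : Set ℝ) : Type := Lp ℝ 2 (volume.restrict D)

/-- The norm `‖g‖_D = √((g, g)_D)`. -/
def normOn (D : Set ℝ) (g : ℝ → ℝ) : ℝ := Real.sqrt (∫ t in D, g t * g t)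

/-- `v ∈ H¹(D)`, and `w ∈ L²(D)` is its weak derivative: both are square integrable on `D`, and
`∫_D v φ' = - ∫_D w φ` for all smooth `φ` with compact support in `D`. -/
def HasH1Deriv (D : Set ℝ) (v w : ℝ → ℝ) : Prop :=
  MemLp v 2 (volume.restrict D) ∧ MemLp w 2 (volume.restrict D) ∧
    ∀ φ : ℝ → ℝ, ContDiff ℝ (⊤ : ℕ∞) φ → HasCompactSupport φ → tsupport φ ⊆ D →
      ∫ t in D, v t * deriv φ t = -∫ t in D, w t * φ t

/-- Membership in the Sobolev space `H¹(D)`. -/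
def MemH1 (D : Set ℝ) (v : ℝ → ℝ) : Prop := ∃ w : ℝ → ℝ, HasH1Deriv D v w

/-- The trace of `v` at the point `p` of the closure of the interval `D` is zero: the
representative of `v` that is continuous up to the boundary vanishes at `p`. -/
def ZeroTraceAt (D : Set ℝ) (v : ℝ → ℝ) (p : ℝ) : Prop :=
  ∃ v' : ℝ → ℝ, ContinuousOn v' (closure D) ∧ v =ᵐ[volume.restrict D] v' ∧ v' p = 0

/-- The outward unit normal of `(a, b)`, at the boundary points `a` and `b`. -/
def outwardNormal (a p : ℝ) : ℝ := if p = a then -1 else 1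

/-- The inflow boundary of `(a, b)` for the constant velocity `β`. -/
def inflow (a b β : ℝ) : Set ℝ := {p | (p = a ∨ p = b) ∧ β * outwardNormal a p < 0}

/-- The outflow boundary of `(a, b)` for the constant velocity `β`. -/
def outflow (a b β : ℝ) : Set ℝ := {p | (p = a ∨ p = b) ∧ 0 < β * outwardNormal a p}

/-- The function `u ∈ L²(a, b)` is an ultra-weak solution of `β u' = f` in `(a, b)`, `u = 0` on the
inflow boundary: `-(u, β v') = (f, v)` for all `v ∈ H¹(a, b)` (with weak derivative `w`) that
vanish on the outflow boundary. -/
def IsUltraWeakSolution (a b β : ℝ) (f u : L2 (Ioo a b)) : Prop :=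
  ∀ v w : ℝ → ℝ, HasH1Deriv (Ioo a b) v w →
    (∀ p ∈ outflow a b β, ZeroTraceAt (Ioo a b) v p) →
      -∫ t in Ioo a b, u t * (β * w t) = ∫ t in Ioo a b, f t * v t

/-- The residual `⟨R(uh), v⟩ = (f, v) + (uh, β v')`, where `w` is the derivative of `v`. -/
def residual (a b β : ℝ) (f uh : L2 (Ioo a b)) (v w : ℝ → ℝ) : ℝ :=
  (∫ t in Ioo a b, f t * v t) + ∫ t in Ioo a b, uh t * (β * w t)

/-- A mesh of the interval `(a, b)`, given by its vertices `a = x₀ < x₁ < ⋯ < xₙ = b`. -/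
structure Mesh (a b : ℝ) where
  /-- the number of elements -/
  n : ℕ
  /-- the vertices -/
  x : Fin (n + 1) → ℝ
  strictMono : StrictMono x
  left_eq : x 0 = a
  right_eq : x (Fin.last n) = b

namespace Mesh

variable {a b : ℝ} (T : Mesh a b)

/-- The `i`-th element, an open interval between neighbouring vertices. -/
def elem (i : Fin T.n) : Set ℝ := Ioo (T.x i.castSucc) (T.x i.succ)

/-- The diameter of the `i`-th element. -/
def h (i : Fin T.n) : ℝ := T.x i.succ - T.x i.castSucc

/-- The indices of the elements that have the vertex `j`. -/
def star (j : Fin (T.n + 1)) : Set (Fin T.n) := {i | j = i.castSucc ∨ j = i.succ}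

/-- The neighbouring vertex on the left (the vertex itself if it is the first one). -/
def leftNbr (j : Fin (T.n + 1)) : Fin (T.n + 1) := ⟨j - 1, by omega⟩

/-- The neighbouring vertex on the right (the vertex itself if it is the last one). -/
def rightNbr (j : Fin (T.n + 1)) : Fin (T.n + 1) := ⟨min (j + 1) T.n, by omega⟩

/-- The open patch of the one or two elements that have the vertex `j`. -/
def patch (j : Fin (T.n + 1)) : Set ℝ := Ioo (T.x (T.leftNbr j)) (T.x (T.rightNbr j))

/-- The hat function of the vertex `j` (only its values on `[a, b]` matter): piecewise affine,
`1` at the vertex `j`, `0` at all other vertices. -/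
def hat (j : Fin (T.n + 1)) (t : ℝ) : ℝ :=
  if t ≤ T.x j then
    if j = 0 then 1 else max 0 ((t - T.x (T.leftNbr j)) / (T.x j - T.x (T.leftNbr j)))
  else
    if j = Fin.last T.n then 1
    else max 0 ((T.x (T.rightNbr j) - t) / (T.x (T.rightNbr j) - T.x j))

/-- On each element with index in `S`, the function `g` is (almost everywhere) a polynomial of
degree at most `k`. -/
def IsPiecewisePoly (S : Set (Fin T.n)) (k : ℕ) (g : ℝ → ℝ) : Prop :=
  ∀ i ∈ S, ∃ p : Polynomial ℝ, p.natDegree ≤ k ∧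
    g =ᵐ[volume.restrict (T.elem i)] fun t => p.eval t

theorem elem_subset (i : Fin T.n) : T.elem i ⊆ Ioo a b := by
  intro t ht
  have h0 : T.x 0 ≤ T.x i.castSucc := T.strictMono.monotone (Fin.zero_le _)
  have h1 : T.x i.succ ≤ T.x (Fin.last T.n) := T.strictMono.monotone (Fin.le_last _)
  rw [T.left_eq] at h0
  rw [T.right_eq] at h1
  exact ⟨lt_of_le_of_lt h0 ht.1, lt_of_lt_of_le ht.2 h1⟩

/-- The space of piecewise polynomials of degree at most `k` on the mesh, inside `L²(a, b)`. -/
def polySpace (k : ℕ) : Submodule ℝ (L2 (Ioo a b)) where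
  carrier := {g | T.IsPiecewisePoly univ k g}
  add_mem' := by
    intro g g' hg hg' i hi
    obtain ⟨p, hp, hgp⟩ := hg i hi
    obtain ⟨q, hq, hgq⟩ := hg' i hi
    refine ⟨p + q, (Polynomial.natDegree_add_le p q).trans (max_le hp hq), ?_⟩
    have h := ae_restrict_of_ae_restrict_of_subset (T.elem_subset i) (Lp.coeFn_add g g')
    filter_upwards [h, hgp, hgq] with t h1 h2 h3
    exact h1.trans (by simp [h2, h3])
  zero_mem' := by
    intro i _
    refine ⟨0, by simp, ?_⟩
    have h := ae_restrict_of_ae_restrict_of_subset (T.elem_subset i)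
      (Lp.coeFn_zero ℝ 2 (volume.restrict (Ioo a b)))
    filter_upwards [h] with t h1
    exact h1.trans (by simp)
  smul_mem' := by
    intro c g hg i hi
    obtain ⟨p, hp, hgp⟩ := hg i hi
    refine ⟨c • p, (Polynomial.natDegree_smul_le c p).trans hp, ?_⟩
    have h := ae_restrict_of_ae_restrict_of_subset (T.elem_subset i) (Lp.coeFn_smul c g)
    filter_upwards [h, hgp] with t h1 h2
    exact h1.trans (by simp [h2])

theorem exists_mem_elem {t : ℝ} (ht : t ∈ Ioo a b) (hx : ∀ j, t ≠ T.x j) :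
    ∃ i, t ∈ T.elem i := by
  by_contra hne
  have key : ∀ m : ℕ, ∀ hm : m < T.n + 1, T.x ⟨m, hm⟩ < t := by
    intro m
    induction m with
    | zero =>
      intro hm
      have : T.x ⟨0, hm⟩ = a := T.left_eq
      rw [this]
      exact ht.1
    | succ m ih =>
      intro hm
      have h1 := ih (by omega)
      by_contra h2
      have h3 : t < T.x ⟨m + 1, hm⟩ := lt_of_le_of_ne (not_lt.mp h2) (hx _)
      exact hne ⟨⟨m, by omega⟩, h1, h3⟩
  have h4 := key T.n (by omega)
  have h5 : T.x ⟨T.n, by omega⟩ = b := T.right_eq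
  rw [h5] at h4
  exact absurd ht.2 (not_lt.mpr h4.le)

theorem disjoint_elem {i i' : Fin T.n} (hne : i ≠ i') : Disjoint (T.elem i) (T.elem i') := by
  rw [Set.disjoint_left]
  intro t h1 h2
  rcases lt_or_gt_of_ne hne with h | h
  · have : T.x i.succ ≤ T.x i'.castSucc := T.strictMono.monotone (by
      rw [Fin.le_def]; simp; omega)
    exact absurd (h1.2.trans_le this) (not_lt.mpr h2.1.le)
  · have : T.x i'.succ ≤ T.x i.castSucc := T.strictMono.monotone (by
      rw [Fin.le_def]; simp; omega)
    exact absurd (h2.2.trans_le this) (not_lt.mpr h1.1.le)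

theorem memLp_monomial (i : Fin T.n) (m : ℕ) :
    MemLp ((T.elem i).indicator fun t : ℝ => t ^ m) 2 (volume.restrict (Ioo a b)) := by
  refine MemLp.indicator measurableSet_Ioo ?_
  refine MemLp.of_bound (continuous_pow m).aestronglyMeasurable (max |a| |b| ^ m) ?_
  refine (ae_restrict_iff' measurableSet_Ioo).mpr (Filter.Eventually.of_forall fun t ht => ?_)
  rw [norm_pow]
  exact pow_le_pow_left₀ (norm_nonneg t) (abs_le_max_abs_abs ht.1.le ht.2.le) m

instance finiteDimensional_polySpace (k : ℕ) : FiniteDimensional ℝ (T.polySpace k) := by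
  let e : Fin T.n × Fin (k + 1) → L2 (Ioo a b) := fun q => (T.memLp_monomial q.1 q.2).toLp _
  have hle : T.polySpace k ≤ Submodule.span ℝ (Set.range e) := by
    intro g hg
    choose p hp hgp using fun i => hg i (mem_univ i)
    have hsum : g = ∑ q : Fin T.n × Fin (k + 1), (p q.1).coeff q.2 • e q := by
      apply Lp.ext
      have h1 : ∀ S : Finset (Fin T.n × Fin (k + 1)),
          (∑ q ∈ S, (p q.1).coeff q.2 • e q : L2 (Ioo a b)) =ᵐ[volume.restrict (Ioo a b)]
            fun t => ∑ q ∈ S, (p q.1).coeff q.2 *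
              (T.elem q.1).indicator (fun t : ℝ => t ^ (q.2 : ℕ)) t := by
        classical
        intro S
        induction S using Finset.induction_on with
        | empty =>
          filter_upwards [Lp.coeFn_zero ℝ 2 (volume.restrict (Ioo a b))] with t ht
          simpa using ht
        | insert q S hq ih =>
          simp only [Finset.sum_insert hq]
          filter_upwards [ih, Lp.coeFn_add ((p q.1).coeff q.2 • e q)
            (∑ q ∈ S, (p q.1).coeff q.2 • e q), Lp.coeFn_smul ((p q.1).coeff (q.2 : ℕ)) (e q),
            (T.memLp_monomial q.1 q.2).coeFn_toLp] with t h1 h2 h3 h4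
          rw [h2, Pi.add_apply, h1, h3, Pi.smul_apply, h4, smul_eq_mul]
      have h2 : ∀ i, ∀ᵐ t ∂volume, t ∈ T.elem i → g t = (p i).eval t := fun i =>
        (ae_restrict_iff' measurableSet_Ioo).mp (hgp i)
      have h3 : ∀ᵐ t ∂volume, ∀ j, t ≠ T.x j := ae_all_iff.mpr fun j =>
        compl_mem_ae_iff.mpr (measure_singleton (T.x j))
      have h4 := h1 Finset.univ
      refine Filter.EventuallyEq.trans ?_ h4.symm
      refine (ae_restrict_iff' measurableSet_Ioo).mpr ?_
      filter_upwards [ae_all_iff.mpr h2, h3] with t ht2 ht3 ht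
      obtain ⟨i, hi⟩ := T.exists_mem_elem ht ht3
      rw [ht2 i hi, Fintype.sum_prod_type, Finset.sum_eq_single i]
      · rw [Polynomial.eval_eq_sum_range' (Nat.lt_succ_of_le (hp i)), Finset.sum_range]
        simp [indicator_of_mem hi]
      · intro i' _ hne
        refine Finset.sum_eq_zero fun m _ => ?_
        rw [indicator_of_notMem, mul_zero]
        exact Set.disjoint_left.mp (T.disjoint_elem hne.symm) hi
      · simp
    rw [hsum]
    exact Submodule.sum_mem _ fun q _ =>
      Submodule.smul_mem _ _ (Submodule.subset_span (mem_range_self q))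
  have : FiniteDimensional ℝ (Submodule.span ℝ (Set.range e)) :=
    FiniteDimensional.span_of_finite ℝ (Set.finite_range e)
  exact Submodule.finiteDimensional_of_le hle

/-- The residual of `uh` is orthogonal to the hat functions of all interior and inflow vertices.
(The derivative of a hat function exists, and is its weak derivative, off the vertices.) -/
def HatOrthogonal (β : ℝ) (f uh : L2 (Ioo a b)) : Prop :=
  ∀ j : Fin (T.n + 1), (T.x j ∈ Ioo a b ∨ T.x j ∈ inflow a b β) →
    residual a b β f uh (T.hat j) (deriv (T.hat j)) = 0

/-- The local problem on the patch `ω` of the vertex `j`, with hat function `ψ`: `s` is a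
continuous (that is, `H¹(ω)`) piecewise polynomial of degree at most `k` with
`(β (ψ s)', v)_ω = (f ψ + β ψ' uh, v)_ω` for all piecewise polynomials `v` of degree at most `k`
on the patch, where `d` is the weak derivative of `ψ s`. -/
def IsLocalSolution (β : ℝ) (f uh : L2 (Ioo a b)) (k : ℕ) (j : Fin (T.n + 1))
    (s : L2 (T.patch j)) : Prop :=
  T.IsPiecewisePoly (T.star j) k s ∧ MemH1 (T.patch j) s ∧
    ∃ d : ℝ → ℝ, HasH1Deriv (T.patch j) (fun t => T.hat j t * s t) d ∧
      ∀ v : ℝ → ℝ, T.IsPiecewisePoly (T.star j) k v →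
        ∫ t in T.patch j, β * d t * v t =
          ∫ t in T.patch j, (f t * T.hat j t + β * deriv (T.hat j) t * uh t) * v t

/-- The global reconstruction `∑ⱼ ψⱼ sⱼ` (each `ψⱼ` vanishes on `(a, b)` outside of its patch). -/
def reconstruction (s : (j : Fin (T.n + 1)) → L2 (T.patch j)) (t : ℝ) : ℝ :=
  ∑ j, T.hat j t * s j t

end Mesh

end Advection1D

end

open Advection1D

open MeasureTheory Set

noncomputable section

namespace Advection1D

open Polynomial

/-! Let `s_h` denote the reconstruction. By the triangle inequality on each element `K` it suffices
to show `‖u - s_h‖_K ≤ h_K / (π|β|) ‖f - Πf‖_K`. This is Wirtinger's inequality with constant `h_K /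
π` (`IsPrimitive.integral_sq_le`), applied to `u - s_h`, which has derivative `(f - Πf) / β` on `K`
and vanishes at both ends of `K`.

The derivative (`Mesh.SolvesOn.derivative_eq`): only the hat functions of the two end points of `K`
live on `K`; they sum to `1` and their derivatives to `0`. Adding the two local problems, the terms
with `uh` cancel and `(β s_h', q)_K = (f, q)_K` remains for all polynomials `q` of degree at most
`k`. As `s_h'` has degree at most `k` itself, `β s_h' = Πf` on `K`.

The vertex values (`Mesh.eval_eq_of_isPrimitive`): testing a local problem on one element with `1`
expresses the value of the local solution at its vertex, up to sign, by the integral of the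
right-hand side. The residual of a hat function is the sum of these integrals. Its vanishing
therefore says that the one-sided values agree at an interior vertex, and that the value is zero at
the inflow vertex. Moreover `Πf` and `f` have the same mean on `K`, so `u` and `s_h` have the same
increment over `K`. Both start from `0` at the inflow, hence they agree at all vertices.

Well-posedness: `u` is the primitive of `f / β` that vanishes at the inflow, by integration by
parts; for uniqueness, the test function is a primitive of the difference of two solutions. The
local test functions may jump, so the local problems decouple into square linear systems on single
elements. If `p` solves the homogeneous system, testing with `(ψp)'` gives `(ψp)' = 0`, and `p = 0`
because `ψ` has a zero. Orthogonality to the hat functions is what makes the two pieces fit together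
continuously on an interior patch. -/

/-- On `[c, d]`, the function `V` is the absolutely continuous primitive of `v`. -/
def IsPrimitive (c d : ℝ) (V v : ℝ → ℝ) : Prop :=
  IntervalIntegrable v volume c d ∧ ∀ t ∈ Icc c d, V t = V c + ∫ s in c..t, v s

/-! ### Absolutely continuous primitives and integration by parts -/

section Primitive

variable {c d : ℝ} {V W v w : ℝ → ℝ}

theorem isPrimitive_integral (C : ℝ) (hv : IntervalIntegrable v volume c d) :
    IsPrimitive c d (fun t => C + ∫ s in c..t, v s) v :=
  ⟨hv, fun t _ => by simp⟩

theorem isPrimitive_of_hasDerivAt (hV : ∀ t ∈ Icc c d, HasDerivAt V (v t) t)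
    (hv : ContinuousOn v (Icc c d)) (hcd : c ≤ d) : IsPrimitive c d V v := by
  refine ⟨hv.intervalIntegrable_of_Icc hcd, fun t ht => ?_⟩
  have hsub : uIcc c t ⊆ Icc c d := by
    rw [uIcc_of_le ht.1]
    exact Icc_subset_Icc_right ht.2
  rw [intervalIntegral.integral_eq_sub_of_hasDerivAt (fun s hs => hV s (hsub hs))
    (hv.mono hsub).intervalIntegrable]
  ring

theorem IsPrimitive.mono {c' d' : ℝ} (h : IsPrimitive c d V v) (hc : c ≤ c') (hcd' : c' ≤ d')
    (hd : d' ≤ d) : IsPrimitive c' d' V v := by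
  have hint : ∀ {s t}, s ∈ Icc c d → t ∈ Icc c d → IntervalIntegrable v volume s t := by
    intro s t hs ht
    refine h.1.mono_set ?_
    rw [uIcc_of_le (hs.1.trans hs.2)]
    exact uIcc_subset_Icc hs ht
  have hcm : c ∈ Icc c d := ⟨le_rfl, hc.trans (hcd'.trans hd)⟩
  have hcm' : c' ∈ Icc c d := ⟨hc, hcd'.trans hd⟩
  refine ⟨hint hcm' ⟨hc.trans hcd', hd⟩, fun t ht => ?_⟩
  have htm : t ∈ Icc c d := ⟨hc.trans ht.1, ht.2.trans hd⟩
  rw [h.2 t htm, h.2 c' hcm', ← intervalIntegral.integral_add_adjacent_intervals (hint hcm hcm')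
    (hint hcm' htm)]
  ring

theorem IsPrimitive.glue {m : ℝ} (h1 : IsPrimitive c m V v) (h2 : IsPrimitive m d V v)
    (hcm : c ≤ m) : IsPrimitive c d V v := by
  refine ⟨h1.1.trans h2.1, fun t ht => ?_⟩
  rcases le_total t m with htm | htm
  · exact h1.2 t ⟨ht.1, htm⟩
  · have h3 := (h2.mono le_rfl htm ht.2).1
    rw [h2.2 t ⟨htm, ht.2⟩, h1.2 m ⟨hcm, le_rfl⟩,
      ← intervalIntegral.integral_add_adjacent_intervals h1.1 h3, add_assoc]

theorem IsPrimitive.congr (h : IsPrimitive c d V v) (hcd : c ≤ d) (hV : ∀ t ∈ Icc c d, W t = V t)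
    (hv : w =ᵐ[volume.restrict (Ioo c d)] v) : IsPrimitive c d W w := by
  rw [restrict_Ioo_eq_restrict_Ioc] at hv
  refine ⟨h.1.congr_ae (by rw [uIoc_of_le hcd]; exact hv.symm), fun t ht => ?_⟩
  rw [hV t ht, hV c ⟨le_rfl, hcd⟩, h.2 t ht]
  congr 1
  refine intervalIntegral.integral_congr_ae_restrict ?_
  rw [uIoc_of_le ht.1]
  exact Filter.EventuallyEq.symm
    (ae_restrict_of_ae_restrict_of_subset (Ioc_subset_Ioc_right ht.2) hv)

theorem IsPrimitive.sub (hV : IsPrimitive c d V v) (hW : IsPrimitive c d W w) :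
    IsPrimitive c d (fun t => V t - W t) (fun t => v t - w t) := by
  refine ⟨hV.1.sub hW.1, fun t ht => ?_⟩
  have hv := (hV.mono le_rfl ht.1 ht.2).1
  have hw := (hW.mono le_rfl ht.1 ht.2).1
  rw [intervalIntegral.integral_sub hv hw]
  simp only [hV.2 t ht, hW.2 t ht]
  ring

/-- `V` is only controlled on `[c, d]`, so its two-sided derivative at an end point is meaningless.
The integral formula extends it beyond the end points, and results on derivatives are applied to
that extension. -/
theorem IsPrimitive.absolutelyContinuousOnInterval_integral (h : IsPrimitive c d V v) :
    AbsolutelyContinuousOnInterval (fun t => V c + ∫ s in c..t, v s) c d := by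
  have h1 := h.1.absolutelyContinuousOnInterval_intervalIntegral (c := c) left_mem_uIcc
  have h2 : AbsolutelyContinuousOnInterval (fun _ : ℝ => V c) c d :=
    (LipschitzWith.const (V c)).lipschitzOnWith.absolutelyContinuousOnInterval
  exact h2.add h1

theorem IsPrimitive.continuousOn (h : IsPrimitive c d V v) (hcd : c ≤ d) :
    ContinuousOn V (Icc c d) := by
  have h1 := h.absolutelyContinuousOnInterval_integral.continuousOn
  rw [uIcc_of_le hcd] at h1
  exact h1.congr h.2

theorem IsPrimitive.ae_hasDerivAt_integral (h : IsPrimitive c d V v) :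
    ∀ᵐ t, t ∈ uIcc c d → HasDerivAt (fun t => V c + ∫ s in c..t, v s) (v t) t := by
  filter_upwards [h.1.ae_hasDerivAt_integral] with t ht htm
  exact (ht htm c left_mem_uIcc).const_add _

/-- Integration by parts. -/
theorem IsPrimitive.integral_mul (hV : IsPrimitive c d V v) (hW : IsPrimitive c d W w)
    (hcd : c ≤ d) : ∫ t in c..d, (v t * W t + V t * w t) = V d * W d - V c * W c := by
  have h := AbsolutelyContinuousOnInterval.integral_deriv_mul_eq_sub
    hV.absolutelyContinuousOnInterval_integral hW.absolutelyContinuousOnInterval_integral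
  rw [← hV.2 d ⟨hcd, le_rfl⟩, ← hW.2 d ⟨hcd, le_rfl⟩] at h
  simp only [intervalIntegral.integral_same, add_zero] at h
  rw [← h]
  refine intervalIntegral.integral_congr_ae ?_
  filter_upwards [hV.ae_hasDerivAt_integral, hW.ae_hasDerivAt_integral] with t h1 h2 ht
  have ht' : t ∈ Icc c d := by
    rw [uIoc_of_le hcd] at ht
    exact Ioc_subset_Icc_self ht
  rw [← uIcc_of_le hcd] at ht'
  rw [(h1 ht').deriv, (h2 ht').deriv]
  rw [uIcc_of_le hcd] at ht'
  rw [hV.2 t ht', hW.2 t ht']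

theorem IsPrimitive.mul (hV : IsPrimitive c d V v) (hW : IsPrimitive c d W w) (hcd : c ≤ d) :
    IsPrimitive c d (fun t => V t * W t) (fun t => v t * W t + V t * w t) := by
  refine ⟨?_, fun t ht => ?_⟩
  · have h1 := hV.continuousOn hcd
    have h2 := hW.continuousOn hcd
    rw [← uIcc_of_le hcd] at h1 h2
    exact (hV.1.mul_continuousOn h2).add (hW.1.continuousOn_mul h1)
  · rw [(hV.mono le_rfl ht.1 ht.2).integral_mul (hW.mono le_rfl ht.1 ht.2) ht.1]
    ring

theorem memLp_two_intervalIntegrable (hv : MemLp v 2 (volume.restrict (Ioo c d))) (hcd : c ≤ d) :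
    IntervalIntegrable v volume c d := by
  rw [intervalIntegrable_iff_integrableOn_Ioo_of_le hcd]
  exact hv.integrable (by norm_num)

theorem integral_eq_setIntegral_Ioo (hcd : c ≤ d) (v : ℝ → ℝ) :
    ∫ t in c..d, v t = ∫ t in Ioo c d, v t := by
  rw [intervalIntegral.integral_of_le hcd, integral_Ioc_eq_integral_Ioo]

theorem memLp_of_continuousOn_Icc (hv : ContinuousOn v (Icc c d)) :
    MemLp v 2 (volume.restrict (Ioo c d)) := by
  refine MemLp.mono_measure (Measure.restrict_mono Ioo_subset_Icc_self le_rfl) ?_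
  obtain ⟨C, hC⟩ := isCompact_Icc.exists_bound_of_continuousOn hv
  exact MemLp.of_bound (hv.aestronglyMeasurable measurableSet_Icc) C
    ((ae_restrict_iff' measurableSet_Icc).mpr (Filter.Eventually.of_forall hC))

/-! ### Wirtinger's inequality with the optimal constant -/

/-- Wirtinger's inequality, with a constant that is not yet optimal. -/
theorem IsPrimitive.sq_mul_integral_sq_le (h : IsPrimitive c d V v) (hcd : c < d)
    (hv : MemLp v 2 (volume.restrict (Ioo c d))) (hc : V c = 0) (hd : V d = 0) {ω : ℝ}
    (hω0 : 0 < ω) (hω : ω * (d - c) < Real.pi) :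
    ω ^ 2 * ∫ t in Ioo c d, V t * V t ≤ ∫ t in Ioo c d, v t * v t := by
  -- `κ` solves the Riccati equation `κ' = ω² + κ²`. Centred at the midpoint, it has no pole in `[c,
  -- d]` because `ω (d - c) < π`.
  set κ : ℝ → ℝ := fun t => ω * Real.tan (ω * (t - (c + d) / 2)) with hκ
  have hcos : ∀ t ∈ Icc c d, 0 < Real.cos (ω * (t - (c + d) / 2)) := by
    intro t ht
    apply Real.cos_pos_of_mem_Ioo
    constructor <;> nlinarith [ht.1, ht.2]
  have hder : ∀ t ∈ Icc c d, HasDerivAt κ (ω ^ 2 + κ t ^ 2) t := by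
    intro t ht
    have h1 : HasDerivAt (fun t => ω * (t - (c + d) / 2)) ω t := by
      simpa using ((hasDerivAt_id t).sub_const ((c + d) / 2)).const_mul ω
    have h2 := ((Real.hasDerivAt_tan (hcos t ht).ne').comp t h1).const_mul ω
    convert! h2 using 1
    simp only [hκ, Real.tan_eq_sin_div_cos]
    have := (hcos t ht).ne'
    generalize ω * (t - (c + d) / 2) = x at this ⊢
    field_simp
    rw [Real.sin_sq]
    ring
  have hκc : ContinuousOn κ (Icc c d) := fun t ht => (hder t ht).continuousAt.continuousWithinAt
  have hκp : IsPrimitive c d κ (fun t => ω ^ 2 + κ t ^ 2) :=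
    isPrimitive_of_hasDerivAt hder (continuousOn_const.add (hκc.pow 2)) hcd.le
  have hVc := h.continuousOn hcd.le
  -- The integral of `(κ V²)'` is zero because `V` vanishes at both ends.
  have hprod := (hκp.mul (h.mul h hcd.le) hcd.le).2 d ⟨hcd.le, le_rfl⟩
  simp only [hc, hd, mul_zero, zero_add] at hprod
  rw [integral_eq_setIntegral_Ioo hcd.le] at hprod
  have hVm := memLp_of_continuousOn_Icc hVc
  have hκV := memLp_of_continuousOn_Icc (hκc.mul hVc)
  have i1 : IntegrableOn (fun t => v t * v t) (Ioo c d) := hv.integrable_mul hv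
  have i2 : IntegrableOn (fun t => V t * V t) (Ioo c d) := hVm.integrable_mul hVm
  have i3 : IntegrableOn (fun t => (v t + κ t * V t) * (v t + κ t * V t)) (Ioo c d) :=
    (hv.add hκV).integrable_mul (hv.add hκV)
  -- Completing the square: `(v + κV)² = v² - ω² V² + (κ V²)'`.
  have key : ∫ t in Ioo c d, (v t + κ t * V t) * (v t + κ t * V t) =
      (∫ t in Ioo c d, v t * v t) - ω ^ 2 * ∫ t in Ioo c d, V t * V t := by
    have i4 : IntegrableOn (fun t => v t * v t - ω ^ 2 * (V t * V t)) (Ioo c d) :=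
      i1.sub (i2.const_mul _)
    rw [← integral_const_mul, ← integral_sub i1 (i2.const_mul _), ← sub_eq_zero,
      ← integral_sub i3 i4, hprod]
    congr 1
    ext t
    ring
  have hnn : 0 ≤ ∫ t in Ioo c d, (v t + κ t * V t) * (v t + κ t * V t) :=
    integral_nonneg fun t => mul_self_nonneg _
  linarith

/-- Wirtinger's inequality for functions that vanish at both end points. -/
theorem IsPrimitive.integral_sq_le (h : IsPrimitive c d V v) (hcd : c < d)
    (hv : MemLp v 2 (volume.restrict (Ioo c d))) (hc : V c = 0) (hd : V d = 0) :
    (∫ t in Ioo c d, V t * V t) ≤ ((d - c) / Real.pi) ^ 2 * ∫ t in Ioo c d, v t * v t := by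
  have hpos : 0 < d - c := sub_pos.mpr hcd
  have hlim : (Real.pi / (d - c)) ^ 2 * (∫ t in Ioo c d, V t * V t) ≤
      ∫ t in Ioo c d, v t * v t := by
    have hcont : Filter.Tendsto (fun ω : ℝ => ω ^ 2 * ∫ t in Ioo c d, V t * V t)
        (nhdsWithin (Real.pi / (d - c)) (Iio (Real.pi / (d - c))))
        (nhds ((Real.pi / (d - c)) ^ 2 * ∫ t in Ioo c d, V t * V t)) :=
      ((continuous_pow 2).mul continuous_const).continuousAt.mono_left nhdsWithin_le_nhds
    refine le_of_tendsto hcont ?_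
    filter_upwards [Ioo_mem_nhdsLT (div_pos Real.pi_pos hpos)] with ω hω
    exact h.sq_mul_integral_sq_le hcd hv hc hd hω.1 ((lt_div_iff₀ hpos).mp hω.2)
  calc (∫ t in Ioo c d, V t * V t)
      = ((d - c) / Real.pi) ^ 2 * ((Real.pi / (d - c)) ^ 2 * ∫ t in Ioo c d, V t * V t) := by
        field_simp
    _ ≤ _ := mul_le_mul_of_nonneg_left hlim (sq_nonneg _)

end Primitive

/-! ### Weak derivatives, their primitives and traces -/

section WeakDerivative

variable {c d : ℝ} {V v w : ℝ → ℝ}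

theorem setIntegral_eq_of_tsupport_subset {D D' : Set ℝ} (hD' : D' ⊆ D) (hDm : MeasurableSet D)
    {g φ : ℝ → ℝ} (hφ : tsupport φ ⊆ D') :
    ∫ t in D', g t * φ t = ∫ t in D, g t * φ t := by
  refine (setIntegral_eq_of_subset_of_forall_sdiff_eq_zero hDm hD' fun t ht => ?_).symm
  rw [image_eq_zero_of_notMem_tsupport fun h => ht.2 (hφ h), mul_zero]

theorem integral_smul_eq_setIntegral {D : Set ℝ} {g φ : ℝ → ℝ} (hφ : tsupport φ ⊆ D) :
    ∫ t, φ t • g t = ∫ t in D, φ t • g t := by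
  refine (setIntegral_eq_integral_of_forall_compl_eq_zero fun t ht => ?_).symm
  rw [image_eq_zero_of_notMem_tsupport fun h => ht (hφ h), zero_smul]

theorem HasH1Deriv.mono {D D' : Set ℝ} (h : HasH1Deriv D v w) (hD' : D' ⊆ D)
    (hDm : MeasurableSet D) : HasH1Deriv D' v w := by
  refine ⟨h.1.mono_measure (Measure.restrict_mono hD' le_rfl),
    h.2.1.mono_measure (Measure.restrict_mono hD' le_rfl), fun φ h1 h2 h3 => ?_⟩
  rw [setIntegral_eq_of_tsupport_subset hD' hDm h3,
    setIntegral_eq_of_tsupport_subset hD' hDm (tsupport_deriv_subset.trans h3)]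
  exact h.2.2 φ h1 h2 (h3.trans hD')

theorem HasH1Deriv.congr {D : Set ℝ} {v' w' : ℝ → ℝ} (h : HasH1Deriv D v w)
    (hv : v' =ᵐ[volume.restrict D] v) (hw : w' =ᵐ[volume.restrict D] w) : HasH1Deriv D v' w' := by
  refine ⟨(memLp_congr_ae hv).mpr h.1, (memLp_congr_ae hw).mpr h.2.1, fun φ h1 h2 h3 => ?_⟩
  have e1 : ∫ t in D, v' t * deriv φ t = ∫ t in D, v t * deriv φ t :=
    integral_congr_ae (by filter_upwards [hv] with t ht; rw [ht])
  have e2 : ∫ t in D, w' t * φ t = ∫ t in D, w t * φ t :=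
    integral_congr_ae (by filter_upwards [hw] with t ht; rw [ht])
  rw [e1, e2]
  exact h.2.2 φ h1 h2 h3

theorem locallyIntegrableOn_of_memLp {D : Set ℝ} (hv : MemLp v 2 (volume.restrict D)) :
    LocallyIntegrableOn v D := by
  have := hv.locallyIntegrable (by norm_num)
  exact (locallyIntegrableOn_of_locallyIntegrable_restrict this)

/-- The difference of two weak derivatives is orthogonal to all test functions, so the fundamental
lemma of the calculus of variations applies. -/
theorem HasH1Deriv.unique {w' : ℝ → ℝ} (h : HasH1Deriv (Ioo c d) v w)
    (h' : HasH1Deriv (Ioo c d) v w') : w =ᵐ[volume.restrict (Ioo c d)] w' := by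
  have hloc := locallyIntegrableOn_of_memLp (h.2.1.sub h'.2.1)
  have h0 := isOpen_Ioo.ae_eq_zero_of_integral_contDiff_smul_eq_zero hloc ?_
  · filter_upwards [(ae_restrict_iff' measurableSet_Ioo).mpr h0] with t ht
    exact sub_eq_zero.mp ht
  · intro φ h1 h2 h3
    rw [integral_smul_eq_setIntegral h3]
    have e := (h.2.2 φ h1 h2 h3).symm.trans (h'.2.2 φ h1 h2 h3)
    have hφ := memLp_of_continuousOn_Icc (c := c) (d := d) h1.continuous.continuousOn
    have i1 : IntegrableOn (fun t => w t * φ t) (Ioo c d) := h.2.1.integrable_mul hφ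
    have i2 : IntegrableOn (fun t => w' t * φ t) (Ioo c d) := h'.2.1.integrable_mul hφ
    calc _ = ∫ t in Ioo c d, (w t * φ t - w' t * φ t) := by
          congr 1
          ext t
          simp only [smul_eq_mul, Pi.sub_apply]
          ring
      _ = 0 := by
          rw [integral_sub i1 i2]
          linarith

theorem eq_zero_left_right_of_tsupport_subset {φ : ℝ → ℝ} (hφ : tsupport φ ⊆ Ioo c d) :
    φ c = 0 ∧ φ d = 0 :=
  ⟨image_eq_zero_of_notMem_tsupport fun h => lt_irrefl _ (hφ h).1,
    image_eq_zero_of_notMem_tsupport fun h => lt_irrefl _ (hφ h).2⟩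

theorem IsPrimitive.hasH1Deriv (h : IsPrimitive c d V v) (hcd : c ≤ d)
    (hv : MemLp v 2 (volume.restrict (Ioo c d))) : HasH1Deriv (Ioo c d) V v := by
  have hVm := memLp_of_continuousOn_Icc (h.continuousOn hcd)
  refine ⟨hVm, hv, fun φ h1 _ h3 => ?_⟩
  have hdc : Continuous (deriv φ) := h1.continuous_deriv (by simp)
  have hφ : IsPrimitive c d φ (deriv φ) :=
    isPrimitive_of_hasDerivAt (fun t _ => (h1.differentiable (by simp) t).hasDerivAt)
      hdc.continuousOn hcd
  have e := h.integral_mul hφ hcd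
  obtain ⟨e1, e2⟩ := eq_zero_left_right_of_tsupport_subset h3
  have i1 : IntegrableOn (fun t => v t * φ t) (Ioo c d) :=
    hv.integrable_mul (memLp_of_continuousOn_Icc h1.continuous.continuousOn)
  have i2 : IntegrableOn (fun t => V t * deriv φ t) (Ioo c d) :=
    hVm.integrable_mul (memLp_of_continuousOn_Icc hdc.continuousOn)
  rw [e1, e2, integral_eq_setIntegral_Ioo hcd, integral_add i1 i2] at e
  linarith

/-- The primitive that starts at `c` vanishes to the left of the support of `η`; the zero mean makes
it vanish to the right as well. This characterises derivatives of test functions. -/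
theorem exists_primitive_of_integral_eq_zero {η : ℝ → ℝ} (hη : ContDiff ℝ (⊤ : ℕ∞) η)
    {c' d' : ℝ} (hc : c < c') (hd : d' < d) (hs : ∀ t, t ∉ Icc c' d' → η t = 0)
    (h0 : ∫ t in c..d, η t = 0) :
    ∃ φ : ℝ → ℝ, ContDiff ℝ (⊤ : ℕ∞) φ ∧ HasCompactSupport φ ∧ tsupport φ ⊆ Ioo c d ∧
      deriv φ = η := by
  have hcont := hη.continuous
  have hint : ∀ s t, IntervalIntegrable η volume s t := fun s t => hcont.intervalIntegrable s t
  set φ : ℝ → ℝ := fun t => ∫ s in c..t, η s with hφ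
  have hder : ∀ t, HasDerivAt φ (η t) t := fun t => hcont.integral_hasStrictDerivAt c t |>.hasDerivAt
  have hzero : ∀ t, t ∉ Icc c' d' → φ t = 0 := by
    intro t ht
    rcases lt_or_ge t c' with h | h
    · refine (intervalIntegral.integral_congr (g := fun _ => 0) fun s hs' => hs s fun hs'' => ?_).trans
        (by simp)
      have : s ≤ max c t := hs'.2
      rcases le_max_iff.mp this with h1 | h1
      · linarith [hs''.1]
      · linarith [hs''.1]
    · have h' : d' < t := lt_of_not_ge fun h'' => ht ⟨h, h''⟩
      have h1 : ∫ s in d..t, η s = 0 := by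
        refine (intervalIntegral.integral_congr (g := fun _ => 0)
          fun s hs' => hs s fun hs'' => ?_).trans (by simp)
        have : min d t ≤ s := hs'.1
        rcases min_le_iff.mp this with h1 | h1
        · linarith [hs''.2]
        · linarith [hs''.2]
      have h2 := intervalIntegral.integral_add_adjacent_intervals (hint c d) (hint d t)
      simp only [hφ]
      linarith
  have hsub : tsupport φ ⊆ Icc c' d' :=
    closure_minimal (fun t ht => by_contra fun h => ht (hzero t h)) isClosed_Icc
  have hderiv : deriv φ = η := funext fun t => (hder t).deriv
  refine ⟨φ, ?_, isCompact_Icc.of_isClosed_subset (isClosed_tsupport φ) hsub,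
    hsub.trans fun t ht => ⟨hc.trans_le ht.1, ht.2.trans_lt hd⟩, hderiv⟩
  rw [contDiff_infty_iff_deriv, hderiv]
  exact ⟨fun t => (hder t).differentiableAt, hη⟩

/-- The lemma of du Bois-Reymond. -/
theorem ae_eq_const_of_integral_mul_deriv_eq_zero (hcd : c < d) {z : ℝ → ℝ}
    (hz : MemLp z 2 (volume.restrict (Ioo c d)))
    (h : ∀ φ : ℝ → ℝ, ContDiff ℝ (⊤ : ℕ∞) φ → HasCompactSupport φ → tsupport φ ⊆ Ioo c d →
      ∫ t in Ioo c d, z t * deriv φ t = 0) :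
    ∃ C : ℝ, z =ᵐ[volume.restrict (Ioo c d)] fun _ => C := by
  set m := (c + d) / 2 with hm
  -- Any normalised bump with support inside the interval will do. The constant is then `C = ∫ z b`,
  -- since `b` has integral one.
  let B : ContDiffBump m := ⟨(d - c) / 8, (d - c) / 4, by linarith, by linarith⟩
  set b : ℝ → ℝ := B.normed volume with hb
  have hbs : tsupport b ⊆ Ioo c d := by
    rw [hb, B.tsupport_normed_eq, Real.closedBall_eq_Icc]
    intro t ht
    simp only [B, mem_Icc] at ht
    constructor <;> linarith [ht.1, ht.2]
  have hbd : ContDiff ℝ (⊤ : ℕ∞) b := B.contDiff_normed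
  have hb1 : ∫ t in Ioo c d, b t = 1 := by
    rw [setIntegral_eq_integral_of_forall_compl_eq_zero fun t ht =>
      image_eq_zero_of_notMem_tsupport fun h => ht (hbs h)]
    exact B.integral_normed
  set C := ∫ t in Ioo c d, z t * b t with hC
  refine ⟨C, ?_⟩
  have hL2 : ∀ {g : ℝ → ℝ}, Continuous g → MemLp g 2 (volume.restrict (Ioo c d)) :=
    fun hg => memLp_of_continuousOn_Icc hg.continuousOn
  have hloc := locallyIntegrableOn_of_memLp (hz.sub (hL2 (continuous_const (y := C))))
  have h0 := isOpen_Ioo.ae_eq_zero_of_integral_contDiff_smul_eq_zero hloc ?_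
  · filter_upwards [(ae_restrict_iff' measurableSet_Ioo).mpr h0] with t ht
    exact sub_eq_zero.mp ht
  intro φ h1 h2 h3
  rw [integral_smul_eq_setIntegral h3]
  have hφi : IntegrableOn φ (Ioo c d) := (hL2 h1.continuous).integrable (by norm_num)
  have hbi : IntegrableOn b (Ioo c d) := (hL2 hbd.continuous).integrable (by norm_num)
  set I := ∫ t in Ioo c d, φ t with hI
  -- The least and greatest points of this compact set confine the supports of `φ` and `b` strictly
  -- between `c` and `d`.
  have hK : IsCompact (tsupport φ ∪ Metric.closedBall m ((d - c) / 4)) :=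
    h2.isCompact.union (isCompact_closedBall _ _)
  have hne : (tsupport φ ∪ Metric.closedBall m ((d - c) / 4)).Nonempty :=
    ⟨m, Or.inr (Metric.mem_closedBall_self (by linarith))⟩
  have hKs : tsupport φ ∪ Metric.closedBall m ((d - c) / 4) ⊆ Ioo c d := by
    refine union_subset h3 ?_
    rw [hb, B.tsupport_normed_eq] at hbs
    exact hbs
  obtain ⟨c', hc'⟩ := hK.exists_isLeast hne
  obtain ⟨d', hd'⟩ := hK.exists_isGreatest hne
  -- `φ - (∫ φ) b` has mean zero, so it is the derivative of a test function, and `z` is orthogonal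
  -- to it.
  obtain ⟨ψ, p1, p2, p3, p4⟩ := exists_primitive_of_integral_eq_zero (c := c) (d := d)
    (η := fun t => φ t - I * b t) (h1.sub (contDiff_const.mul hbd)) (hKs hc'.1).1 (hKs hd'.1).2
    (by
      intro t ht
      have hφ0 : φ t = 0 := image_eq_zero_of_notMem_tsupport fun h =>
        ht ⟨hc'.2 (Or.inl h), hd'.2 (Or.inl h)⟩
      have hb0 : b t = 0 := image_eq_zero_of_notMem_tsupport fun h => by
        rw [hb, B.tsupport_normed_eq] at h
        exact ht ⟨hc'.2 (Or.inr h), hd'.2 (Or.inr h)⟩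
      simp [hφ0, hb0]) (by
      rw [integral_eq_setIntegral_Ioo hcd.le, integral_sub hφi (hbi.const_mul _),
        integral_const_mul, hb1]
      simp [hI])
  have e := h ψ p1 p2 p3
  rw [p4] at e
  have i1 : IntegrableOn (fun t => z t * φ t) (Ioo c d) := hz.integrable_mul (hL2 h1.continuous)
  have i2 : IntegrableOn (fun t => z t * b t) (Ioo c d) := hz.integrable_mul (hL2 hbd.continuous)
  have e' : (∫ t in Ioo c d, z t * φ t) - I * C = 0 := by
    rw [← e, hC, ← integral_const_mul, ← integral_sub i1 (i2.const_mul _)]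
    congr 1
    ext t
    ring
  calc _ = ∫ t in Ioo c d, (z t * φ t - C * φ t) := by
        congr 1
        ext t
        simp only [smul_eq_mul, Pi.sub_apply]
        ring
    _ = 0 := by
        rw [integral_sub i1 (hφi.const_mul _), integral_const_mul]
        linarith

/-- `v` minus the integral of `w` has weak derivative zero, hence is constant by du Bois-Reymond.
Adjusting the constant of integration gives the continuous representative. -/
theorem HasH1Deriv.exists_isPrimitive (h : HasH1Deriv (Ioo c d) v w) (hcd : c < d) :
    ∃ V, IsPrimitive c d V w ∧ v =ᵐ[volume.restrict (Ioo c d)] V := by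
  have hp := isPrimitive_integral 0 (memLp_two_intervalIntegrable h.2.1 hcd.le)
  have hW := hp.hasH1Deriv hcd.le h.2.1
  obtain ⟨C, hC⟩ := ae_eq_const_of_integral_mul_deriv_eq_zero hcd (h.1.sub hW.1) (by
    intro φ h1 h2 h3
    have hφ' := memLp_of_continuousOn_Icc (c := c) (d := d)
      (h1.continuous_deriv (by simp)).continuousOn
    have i1 : IntegrableOn (fun t => v t * deriv φ t) (Ioo c d) := h.1.integrable_mul hφ'
    have i2 := hW.1.integrable_mul hφ'
    simp only [Pi.sub_apply, sub_mul]
    refine (integral_sub i1 i2).trans ?_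
    have e2 := hW.2.2 φ h1 h2 h3
    rw [h.2.2 φ h1 h2 h3]
    simp only [Pi.mul_apply]
    rw [e2, sub_self])
  refine ⟨_, isPrimitive_integral C hp.1, ?_⟩
  filter_upwards [hC] with t ht
  simp only [Pi.sub_apply, zero_add] at ht
  linarith

theorem eqOn_Icc_of_ae_eq_Ioo {f g : ℝ → ℝ} (hcd : c < d)
    (hfg : f =ᵐ[volume.restrict (Ioo c d)] g) (hf : ContinuousOn f (Icc c d))
    (hg : ContinuousOn g (Icc c d)) : EqOn f g (Icc c d) := by
  rw [restrict_Ioo_eq_restrict_Icc] at hfg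
  exact Measure.eqOn_Icc_of_ae_eq volume hcd.ne hfg hf hg

theorem zeroTraceAt_iff (hcd : c < d) (hV : ContinuousOn V (Icc c d))
    (hv : v =ᵐ[volume.restrict (Ioo c d)] V) {p : ℝ} (hp : p ∈ Icc c d) :
    ZeroTraceAt (Ioo c d) v p ↔ V p = 0 := by
  unfold ZeroTraceAt
  rw [closure_Ioo hcd.ne]
  refine ⟨?_, fun h => ⟨V, hV, hv, h⟩⟩
  rintro ⟨V', hV', hv', h⟩
  rw [← h]
  exact eqOn_Icc_of_ae_eq_Ioo hcd (hv.symm.trans hv') hV hV' hp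

end WeakDerivative

/-! ### The ultra-weak solution -/

section UltraWeak

variable {a b β : ℝ}

theorem exists_inflow_outflow (hab : a < b) (hβ : β ≠ 0) :
    ∃ e o : ℝ, inflow a b β = {e} ∧ outflow a b β = {o} ∧ (e = a ∧ o = b ∨ e = b ∧ o = a) := by
  have hna : outwardNormal a a = -1 := if_pos rfl
  have hnb : outwardNormal a b = 1 := if_neg hab.ne'
  rcases lt_or_gt_of_ne hβ with h | h
  · refine ⟨b, a, ?_, ?_, Or.inr ⟨rfl, rfl⟩⟩
    · ext p
      simp only [inflow, mem_ofPred_eq, mem_singleton_iff]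
      constructor
      · rintro ⟨rfl | rfl, hp⟩
        · rw [hna] at hp
          linarith
        · rfl
      · rintro rfl
        exact ⟨Or.inr rfl, by rw [hnb]; linarith⟩
    · ext p
      simp only [outflow, mem_ofPred_eq, mem_singleton_iff]
      constructor
      · rintro ⟨rfl | rfl, hp⟩
        · rfl
        · rw [hnb] at hp
          linarith
      · rintro rfl
        exact ⟨Or.inl rfl, by rw [hna]; linarith⟩
  · refine ⟨a, b, ?_, ?_, Or.inl ⟨rfl, rfl⟩⟩
    · ext p
      simp only [inflow, mem_ofPred_eq, mem_singleton_iff]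
      constructor
      · rintro ⟨rfl | rfl, hp⟩
        · rfl
        · rw [hnb] at hp
          linarith
      · rintro rfl
        exact ⟨Or.inl rfl, by rw [hna]; linarith⟩
    · ext p
      simp only [outflow, mem_ofPred_eq, mem_singleton_iff]
      constructor
      · rintro ⟨rfl | rfl, hp⟩
        · rw [hna] at hp
          linarith
        · rfl
      · rintro rfl
        exact ⟨Or.inr rfl, by rw [hnb]; linarith⟩

theorem exists_isPrimitive_eq_zero {c d p : ℝ} {v : ℝ → ℝ} (hv : IntervalIntegrable v volume c d) :
    ∃ V, IsPrimitive c d V v ∧ V p = 0 :=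
  ⟨_, isPrimitive_integral (-∫ s in c..p, v s) hv, by simp⟩

theorem ae_eq_zero_of_integral_mul_self {D : Set ℝ} {z : ℝ → ℝ}
    (hz : MemLp z 2 (volume.restrict D)) (h : ∫ t in D, z t * z t = 0) :
    z =ᵐ[volume.restrict D] 0 := by
  have h1 := (integral_eq_zero_iff_of_nonneg (fun t => mul_self_nonneg (z t))
    (hz.integrable_mul hz)).mp h
  filter_upwards [h1] with t ht
  exact mul_self_eq_zero.mp ht

theorem memLp_div {D : Set ℝ} (f : L2 D) :
    MemLp (fun t => f t / β) 2 (volume.restrict D) := by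
  simpa [div_eq_inv_mul] using (Lp.memLp f).const_mul β⁻¹

/-- A primitive of `f / β` that vanishes at the inflow boundary is an ultra-weak solution. -/
theorem isUltraWeakSolution_of_isPrimitive (hab : a < b) (hβ : β ≠ 0) {f u : L2 (Ioo a b)}
    {e o : ℝ} (ho : outflow a b β = {o}) (heo : e = a ∧ o = b ∨ e = b ∧ o = a) {U : ℝ → ℝ}
    (hU : IsPrimitive a b U (fun t => f t / β)) (hUe : U e = 0)
    (huU : u =ᵐ[volume.restrict (Ioo a b)] U) : IsUltraWeakSolution a b β f u := by
  intro v w hvw htr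
  obtain ⟨V, hV, hvV⟩ := hvw.exists_isPrimitive hab
  have hoI : o ∈ Icc a b := by
    rcases heo with ⟨-, rfl⟩ | ⟨-, rfl⟩
    · exact ⟨hab.le, le_rfl⟩
    · exact ⟨le_rfl, hab.le⟩
  have hVo : V o = 0 :=
    (zeroTraceAt_iff hab (hV.continuousOn hab.le) hvV hoI).mp (htr o (by rw [ho]; rfl))
  have key := hU.integral_mul hV hab.le
  -- At the inflow end `U` vanishes, at the outflow end `V` does.
  have hb : U b * V b - U a * V a = 0 := by
    rcases heo with ⟨rfl, rfl⟩ | ⟨rfl, rfl⟩ <;> rw [hUe, hVo] <;> ring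
  have i1 : IntegrableOn (fun t => f t / β * V t) (Ioo a b) :=
    (memLp_div f).integrable_mul (memLp_of_continuousOn_Icc (hV.continuousOn hab.le))
  have i2 : IntegrableOn (fun t => U t * w t) (Ioo a b) :=
    (memLp_of_continuousOn_Icc (hU.continuousOn hab.le)).integrable_mul hvw.2.1
  rw [hb, integral_eq_setIntegral_Ioo hab.le, integral_add i1 i2] at key
  have e1 : ∫ t in Ioo a b, u t * (β * w t) = β * ∫ t in Ioo a b, U t * w t := by
    rw [← integral_const_mul]
    refine integral_congr_ae ?_
    filter_upwards [huU] with t ht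
    rw [ht]
    ring
  have e2 : ∫ t in Ioo a b, f t * v t = β * ∫ t in Ioo a b, f t / β * V t := by
    rw [← integral_const_mul]
    refine integral_congr_ae ?_
    filter_upwards [hvV] with t ht
    rw [ht]
    field_simp
  rw [e1, e2]
  linear_combination -β * key

/-- The primitive of `u - u'` that vanishes at the outflow is an admissible test function; it yields
`β ‖u - u'‖² = 0`. -/
theorem IsUltraWeakSolution.unique (hab : a < b) (hβ : β ≠ 0) {f u u' : L2 (Ioo a b)} {o : ℝ}
    (ho : outflow a b β = {o}) (hoI : o ∈ Icc a b) (hu : IsUltraWeakSolution a b β f u)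
    (hu' : IsUltraWeakSolution a b β f u') : u = u' := by
  have hz : MemLp (fun t => u t - u' t) 2 (volume.restrict (Ioo a b)) :=
    (Lp.memLp u).sub (Lp.memLp u')
  obtain ⟨V, hV, hVo⟩ :=
    exists_isPrimitive_eq_zero (p := o) (memLp_two_intervalIntegrable hz hab.le)
  have htr : ∀ p ∈ outflow a b β, ZeroTraceAt (Ioo a b) V p := by
    rw [ho]
    rintro p rfl
    exact (zeroTraceAt_iff hab (hV.continuousOn hab.le) Filter.EventuallyEq.rfl hoI).mpr hVo
  have e1 := hu V _ (hV.hasH1Deriv hab.le hz) htr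
  have e2 := hu' V _ (hV.hasH1Deriv hab.le hz) htr
  have i1 : IntegrableOn (fun t => u t * (β * (u t - u' t))) (Ioo a b) :=
    (Lp.memLp u).integrable_mul (hz.const_mul β)
  have i2 : IntegrableOn (fun t => u' t * (β * (u t - u' t))) (Ioo a b) :=
    (Lp.memLp u').integrable_mul (hz.const_mul β)
  have h0 : β * ∫ t in Ioo a b, (u t - u' t) * (u t - u' t) = 0 := by
    have : ∫ t in Ioo a b, (u t * (β * (u t - u' t)) - u' t * (β * (u t - u' t))) = 0 := by
      rw [integral_sub i1 i2]
      linarith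
    rw [← integral_const_mul, ← this]
    congr 1
    ext t
    ring
  have h1 := ae_eq_zero_of_integral_mul_self hz ((mul_eq_zero.mp h0).resolve_left hβ)
  apply Lp.ext
  filter_upwards [h1] with t ht
  exact sub_eq_zero.mp ht

theorem existsUnique_isUltraWeakSolution (hab : a < b) (hβ : β ≠ 0) (f : L2 (Ioo a b)) :
    ∃! u : L2 (Ioo a b), IsUltraWeakSolution a b β f u := by
  obtain ⟨e, o, -, ho, heo⟩ := exists_inflow_outflow hab hβ
  obtain ⟨U, hU, hUe⟩ := exists_isPrimitive_eq_zero (p := e)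
    (memLp_two_intervalIntegrable (memLp_div (β := β) f) hab.le)
  have hm := memLp_of_continuousOn_Icc (hU.continuousOn hab.le)
  have hoI : o ∈ Icc a b := by
    rcases heo with ⟨-, rfl⟩ | ⟨-, rfl⟩
    · exact ⟨hab.le, le_rfl⟩
    · exact ⟨le_rfl, hab.le⟩
  have hsol := isUltraWeakSolution_of_isPrimitive hab hβ ho heo hU hUe hm.coeFn_toLp
  exact ⟨hm.toLp U, hsol, fun u hu => hu.unique hab hβ ho hoI hsol⟩

/-- The ultra-weak solution is the primitive of `f / β` that vanishes at the inflow boundary. -/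
theorem IsUltraWeakSolution.exists_isPrimitive (hab : a < b) (hβ : β ≠ 0) {f u : L2 (Ioo a b)}
    (hu : IsUltraWeakSolution a b β f u) : ∃ U, IsPrimitive a b U (fun t => f t / β) ∧
      (∀ e ∈ inflow a b β, U e = 0) ∧ u =ᵐ[volume.restrict (Ioo a b)] U := by
  obtain ⟨e, o, he, ho, heo⟩ := exists_inflow_outflow hab hβ
  obtain ⟨U, hU, hUe⟩ := exists_isPrimitive_eq_zero (p := e)
    (memLp_two_intervalIntegrable (memLp_div (β := β) f) hab.le)
  have hm := memLp_of_continuousOn_Icc (hU.continuousOn hab.le)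
  have hsol := isUltraWeakSolution_of_isPrimitive hab hβ ho heo hU hUe hm.coeFn_toLp
  refine ⟨U, hU, ?_, ?_⟩
  · rw [he]
    rintro p rfl
    exact hUe
  · rw [(existsUnique_isUltraWeakSolution hab hβ f).unique hu hsol]
    exact hm.coeFn_toLp

end UltraWeak

/-! ### Hat functions as polynomials on elements, patches -/

namespace Mesh

variable {a b : ℝ} (T : Mesh a b)

theorem x_castSucc_lt_succ (i : Fin T.n) : T.x i.castSucc < T.x i.succ :=
  T.strictMono Fin.castSucc_lt_succ

theorem h_pos (i : Fin T.n) : 0 < T.h i := sub_pos.mpr (T.x_castSucc_lt_succ i)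

theorem measurableSet_elem (i : Fin T.n) : MeasurableSet (T.elem i) := measurableSet_Ioo

/-- The polynomial that agrees on the `i`-th element with the hat function of the vertex `j`. -/
def hatPoly (i : Fin T.n) (j : Fin (T.n + 1)) : ℝ[X] :=
  if j = i.castSucc then C (T.h i)⁻¹ * (C (T.x i.succ) - X)
  else if j = i.succ then C (T.h i)⁻¹ * (X - C (T.x i.castSucc)) else 0

theorem hatPoly_castSucc (i : Fin T.n) :
    T.hatPoly i i.castSucc = C (T.h i)⁻¹ * (C (T.x i.succ) - X) := if_pos rfl

theorem hatPoly_succ (i : Fin T.n) :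
    T.hatPoly i i.succ = C (T.h i)⁻¹ * (X - C (T.x i.castSucc)) := by
  rw [hatPoly, if_neg Fin.castSucc_lt_succ.ne', if_pos rfl]

theorem hatPoly_of_notMem {i : Fin T.n} {j : Fin (T.n + 1)} (h : i ∉ T.star j) :
    T.hatPoly i j = 0 := by
  simp only [star, mem_ofPred_eq, not_or] at h
  rw [hatPoly, if_neg h.1, if_neg h.2]

/-- Partition of unity on one element. It cancels the `uh` terms when the two local problems of an
element are added. -/
theorem hatPoly_castSucc_add_succ (i : Fin T.n) :
    T.hatPoly i i.castSucc + T.hatPoly i i.succ = 1 := by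
  rw [hatPoly_castSucc, hatPoly_succ, ← mul_add]
  have : C (T.x i.succ) - X + (X - C (T.x i.castSucc)) = C (T.h i) := by
    rw [Mesh.h, C_sub]
    ring
  rw [this, ← C_mul, inv_mul_cancel₀ (T.h_pos i).ne', C_1]

theorem natDegree_hatPoly_le (i : Fin T.n) (j : Fin (T.n + 1)) :
    (T.hatPoly i j).natDegree ≤ 1 := by
  unfold hatPoly
  split_ifs
  · compute_degree
  · compute_degree
  · simp

theorem eval_hatPoly_self {i : Fin T.n} {j : Fin (T.n + 1)} (h : i ∈ T.star j) :
    (T.hatPoly i j).eval (T.x j) = 1 := by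
  have h0 : T.x i.succ - T.x i.castSucc ≠ 0 := (T.h_pos i).ne'
  rcases h with rfl | rfl
  · simp [hatPoly_castSucc, Mesh.h, h0]
  · simp [hatPoly_succ, Mesh.h, h0]

theorem eval_hatPoly_castSucc_succ (i : Fin T.n) :
    (T.hatPoly i i.castSucc).eval (T.x i.succ) = 0 := by
  simp [hatPoly_castSucc]

theorem eval_hatPoly_succ_castSucc (i : Fin T.n) :
    (T.hatPoly i i.succ).eval (T.x i.castSucc) = 0 := by
  simp [hatPoly_succ]

theorem rightNbr_le_castSucc {i : Fin T.n} {j : Fin (T.n + 1)} (h : j < i.castSucc) :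
    T.rightNbr j ≤ i.castSucc := by
  rw [Fin.lt_def] at h
  rw [Fin.le_def]
  simp only [rightNbr, Fin.val_castSucc] at *
  omega

theorem succ_le_leftNbr {i : Fin T.n} {j : Fin (T.n + 1)} (h : i.succ < j) :
    i.succ ≤ T.leftNbr j := by
  rw [Fin.lt_def] at h
  rw [Fin.le_def]
  simp only [leftNbr, Fin.val_succ] at *
  omega

theorem rightNbr_castSucc (i : Fin T.n) : T.rightNbr i.castSucc = i.succ := by
  ext
  simp only [rightNbr, Fin.val_castSucc, Fin.val_succ]
  omega

theorem leftNbr_succ (i : Fin T.n) : T.leftNbr i.succ = i.castSucc := by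
  ext
  simp [leftNbr]

theorem vertex_cases (i : Fin T.n) (j : Fin (T.n + 1)) :
    j < i.castSucc ∨ j = i.castSucc ∨ j = i.succ ∨ i.succ < j := by
  simp only [Fin.lt_def, Fin.ext_iff, Fin.val_castSucc, Fin.val_succ]
  omega

theorem hat_eq_eval {i : Fin T.n} {t : ℝ} (ht : t ∈ T.elem i) (j : Fin (T.n + 1)) :
    T.hat j t = (T.hatPoly i j).eval t := by
  have hh := T.h_pos i
  rcases T.vertex_cases i j with h | rfl | rfl | h
  · have h1 : T.x j < t := (T.strictMono h).trans ht.1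
    have h2 : j ≠ Fin.last T.n := (h.trans_le (Fin.le_last _)).ne
    have h3 : T.x (T.rightNbr j) ≤ T.x i.castSucc :=
      T.strictMono.monotone (T.rightNbr_le_castSucc h)
    have h4 : T.x j < T.x (T.rightNbr j) := T.strictMono (by
      have := Fin.val_lt_last h2
      rw [Fin.lt_def]
      simp only [rightNbr]
      omega)
    rw [hatPoly_of_notMem, eval_zero, hat, if_neg h1.not_ge, if_neg h2, max_eq_left]
    · exact div_nonpos_of_nonpos_of_nonneg (by linarith [ht.1]) (by linarith)
    · rintro (h' | h')
      · exact h.ne h'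
      · exact (h.trans Fin.castSucc_lt_succ).ne h'
  · rw [hat, if_neg ht.1.not_ge, if_neg (Fin.castSucc_lt_last i).ne, rightNbr_castSucc,
      max_eq_right, hatPoly_castSucc]
    · simp [Mesh.h, div_eq_inv_mul]
    · exact div_nonneg (by linarith [ht.2]) hh.le
  · rw [hat, if_pos ht.2.le, if_neg (Fin.succ_ne_zero i), leftNbr_succ, max_eq_right, hatPoly_succ]
    · simp [Mesh.h, div_eq_inv_mul]
    · exact div_nonneg (by linarith [ht.1]) hh.le
  · have h1 : t < T.x j := ht.2.trans (T.strictMono h)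
    have h2 : j ≠ 0 := ((Fin.zero_le _).trans_lt h).ne'
    have h3 : T.x i.succ ≤ T.x (T.leftNbr j) := T.strictMono.monotone (T.succ_le_leftNbr h)
    have h4 : T.x (T.leftNbr j) < T.x j := T.strictMono (by
      have := Fin.val_ne_zero_iff.mpr h2
      rw [Fin.lt_def]
      simp only [leftNbr]
      omega)
    rw [hatPoly_of_notMem, eval_zero, hat, if_pos h1.le, if_neg h2, max_eq_left]
    · exact div_nonpos_of_nonpos_of_nonneg (by linarith [ht.2]) (by linarith)
    · rintro (h' | h')
      · exact (Fin.castSucc_lt_succ.trans h).ne' h'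
      · exact h.ne' h'

theorem deriv_hat_eq_eval {i : Fin T.n} {t : ℝ} (ht : t ∈ T.elem i) (j : Fin (T.n + 1)) :
    deriv (T.hat j) t = (T.hatPoly i j).derivative.eval t := by
  have : T.hat j =ᶠ[nhds t] fun t => (T.hatPoly i j).eval t := by
    filter_upwards [isOpen_Ioo.mem_nhds ht] with s hs
    exact T.hat_eq_eval hs j
  rw [this.deriv_eq, Polynomial.deriv]

theorem elem_subset_patch {i : Fin T.n} {j : Fin (T.n + 1)} (h : i ∈ T.star j) :
    T.elem i ⊆ T.patch j := by
  rcases h with rfl | rfl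
  · rw [patch, rightNbr_castSucc]
    refine Ioo_subset_Ioo_left (T.strictMono.monotone ?_)
    rw [Fin.le_def]
    simp [leftNbr]
  · rw [patch, leftNbr_succ]
    refine Ioo_subset_Ioo_right (T.strictMono.monotone ?_)
    rw [Fin.le_def]
    simp only [rightNbr, Fin.val_succ]
    omega

theorem mem_star_of_mem {i : Fin T.n} {j : Fin (T.n + 1)} {t : ℝ} (h1 : t ∈ T.elem i)
    (h2 : t ∈ T.patch j) : i ∈ T.star j := by
  rcases T.vertex_cases i j with h | rfl | rfl | h
  · have := T.strictMono.monotone (T.rightNbr_le_castSucc h)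
    exact absurd (h2.2.trans_le this) h1.1.not_gt
  · exact Or.inl rfl
  · exact Or.inr rfl
  · have := T.strictMono.monotone (T.succ_le_leftNbr h)
    exact absurd (this.trans_lt h2.1) h1.2.not_gt

theorem patch_subset (j : Fin (T.n + 1)) : T.patch j ⊆ Ioo a b := by
  refine Ioo_subset_Ioo ?_ ?_
  · exact T.left_eq.symm.le.trans (T.strictMono.monotone (Fin.zero_le _))
  · exact (T.strictMono.monotone (Fin.le_last _)).trans T.right_eq.le

theorem ae_exists_mem_elem : ∀ᵐ t : ℝ, t ∈ Ioo a b → ∃ i, t ∈ T.elem i := by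
  have h3 : ∀ᵐ t : ℝ, ∀ j, t ≠ T.x j := ae_all_iff.mpr fun j =>
    compl_mem_ae_iff.mpr (measure_singleton (T.x j))
  filter_upwards [h3] with t ht hab
  exact T.exists_mem_elem hab ht

theorem ae_restrict_patch {j : Fin (T.n + 1)} {p : ℝ → Prop}
    (h : ∀ i ∈ T.star j, ∀ᵐ t ∂volume.restrict (T.elem i), p t) :
    ∀ᵐ t ∂volume.restrict (T.patch j), p t := by
  have h' : ∀ᵐ t : ℝ, ∀ i, i ∈ T.star j → t ∈ T.elem i → p t :=
    ae_all_iff.mpr fun i => by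
      by_cases hi : i ∈ T.star j
      · filter_upwards [(ae_restrict_iff' (T.measurableSet_elem i)).mp (h i hi)] with t ht _
        exact ht
      · exact Filter.Eventually.of_forall fun t hi' => absurd hi' hi
  refine (ae_restrict_iff' measurableSet_Ioo).mpr ?_
  filter_upwards [T.ae_exists_mem_elem, h'] with t h1 h2 ht
  obtain ⟨i, hi⟩ := h1 (T.patch_subset j ht)
  exact h2 i (T.mem_star_of_mem hi ht) hi

theorem setIntegral_eq_sum {g : ℝ → ℝ} {S : Set ℝ} (hS : S ⊆ Ioo a b) (hSm : MeasurableSet S)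
    (hg : IntegrableOn g S) : ∫ t in S, g t = ∑ i, ∫ t in T.elem i ∩ S, g t := by
  have hd : Pairwise (Function.onFun Disjoint fun i => T.elem i ∩ S) := fun i i' hne =>
    (T.disjoint_elem hne).mono inter_subset_left inter_subset_left
  rw [← integral_iUnion_fintype (fun i => (T.measurableSet_elem i).inter hSm) hd
    (fun i => hg.mono_set inter_subset_right)]
  refine setIntegral_congr_set ?_
  filter_upwards [T.ae_exists_mem_elem] with t ht
  refine propext ⟨fun h => ?_, fun h => ?_⟩
  · obtain ⟨i, hi⟩ := ht (hS h)
    exact mem_iUnion.mpr ⟨i, hi, h⟩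
  · obtain ⟨i, hi⟩ := mem_iUnion.mp h
    exact hi.2

theorem setIntegral_Ioo_eq_sum {g : ℝ → ℝ} (hg : IntegrableOn g (Ioo a b)) :
    ∫ t in Ioo a b, g t = ∑ i, ∫ t in T.elem i, g t := by
  rw [T.setIntegral_eq_sum subset_rfl measurableSet_Ioo hg]
  simp only [inter_eq_left.mpr (T.elem_subset _)]

theorem setIntegral_patch_congr {g g' : ℝ → ℝ} {j : Fin (T.n + 1)}
    (hg : IntegrableOn g (T.patch j)) (hg' : IntegrableOn g' (T.patch j))
    (h : ∀ i ∈ T.star j, ∫ t in T.elem i, g t = ∫ t in T.elem i, g' t) :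
    ∫ t in T.patch j, g t = ∫ t in T.patch j, g' t := by
  rw [T.setIntegral_eq_sum (T.patch_subset j) measurableSet_Ioo hg,
    T.setIntegral_eq_sum (T.patch_subset j) measurableSet_Ioo hg']
  refine Finset.sum_congr rfl fun i _ => ?_
  by_cases hi : i ∈ T.star j
  · rw [inter_eq_left.mpr (T.elem_subset_patch hi)]
    exact h i hi
  · have : T.elem i ∩ T.patch j = ∅ :=
      eq_empty_of_forall_notMem fun t ht => hi (T.mem_star_of_mem ht.1 ht.2)
    rw [this, setIntegral_empty, setIntegral_empty]

/-- Only at an interior vertex do two elements meet; at an end vertex the patch is a single element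
and no continuity condition arises. -/
theorem patch_cases (hab : a < b) (j : Fin (T.n + 1)) :
    (∃ i, T.star j = {i} ∧ T.patch j = T.elem i) ∨
      ∃ i i' : Fin T.n, j = i.succ ∧ j = i'.castSucc ∧
        T.patch j = Ioo (T.x i.castSucc) (T.x i'.succ) := by
  -- A mesh without elements has a single vertex, which would force `a = b`.
  have hn : 0 < T.n := by
    rcases Nat.eq_zero_or_pos T.n with h | h
    · have h1 : (0 : Fin (T.n + 1)) = Fin.last T.n := by
        ext
        simp [h]
      have h2 := T.left_eq
      rw [h1, T.right_eq] at h2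
      exact absurd h2 hab.ne'
    · exact h
  by_cases h0 : j.val = 0
  · refine Or.inl ⟨⟨0, hn⟩, ?_, ?_⟩
    · ext i
      simp only [star, mem_ofPred_eq, mem_singleton_iff, Fin.ext_iff, Fin.val_castSucc,
        Fin.val_succ]
      omega
    · have e : j = (⟨0, hn⟩ : Fin T.n).castSucc := Fin.ext h0
      rw [e, patch, rightNbr_castSucc, elem]
      congr 2
  by_cases hl : j.val = T.n
  · obtain ⟨i, rfl⟩ : ∃ i : Fin T.n, j = i.succ :=
      ⟨⟨T.n - 1, by omega⟩, Fin.ext (by simp; omega)⟩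
    simp only [Fin.val_succ] at hl
    refine Or.inl ⟨i, ?_, ?_⟩
    · ext l
      simp only [star, mem_ofPred_eq, mem_singleton_iff, Fin.ext_iff, Fin.val_castSucc,
        Fin.val_succ]
      omega
    · rw [patch, leftNbr_succ, elem]
      congr 2
      ext
      simp only [rightNbr, Fin.val_succ]
      omega
  · obtain ⟨i, hi⟩ : ∃ i : Fin T.n, j = i.succ :=
      ⟨⟨j.val - 1, by omega⟩, Fin.ext (by simp; omega)⟩
    obtain ⟨i', hi'⟩ : ∃ i : Fin T.n, j = i.castSucc := ⟨⟨j.val, by omega⟩, Fin.ext (by simp)⟩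
    refine Or.inr ⟨i, i', hi, hi', ?_⟩
    rw [patch, ← T.leftNbr_succ i, ← T.rightNbr_castSucc i', ← hi, ← hi']

end Mesh

theorem isPrimitive_polynomial {c d : ℝ} (hcd : c ≤ d) (P : Polynomial ℝ) :
    IsPrimitive c d (fun t => P.eval t) (fun t => P.derivative.eval t) :=
  isPrimitive_of_hasDerivAt (fun t _ => P.hasDerivAt t) P.derivative.continuous.continuousOn hcd

theorem memLp_polynomial {c d : ℝ} (P : Polynomial ℝ) :
    MemLp (fun t => P.eval t) 2 (volume.restrict (Ioo c d)) :=
  memLp_of_continuousOn_Icc P.continuous.continuousOn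

/-- A continuous function that is a polynomial on each element of a patch is in `H¹`, and its weak
derivative is the derivative on each element. -/
theorem Mesh.exists_hasH1Deriv_patch {a b : ℝ} (T : Mesh a b) (hab : a < b) (j : Fin (T.n + 1))
    (P : Fin T.n → Polynomial ℝ) (hP : ∀ i i', j = i.succ → j = i'.castSucc →
      (P i).eval (T.x j) = (P i').eval (T.x j)) :
    ∃ V v : ℝ → ℝ, HasH1Deriv (T.patch j) V v ∧ ∀ i ∈ T.star j, ∀ t ∈ T.elem i,
      V t = (P i).eval t ∧ v t = (P i).derivative.eval t := by
  rcases T.patch_cases hab j with ⟨i, h1, h2⟩ | ⟨i, i', h1, h2, h3⟩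
  · refine ⟨fun t => (P i).eval t, fun t => (P i).derivative.eval t, ?_, ?_⟩
    · rw [h2]
      have hle := (T.x_castSucc_lt_succ i).le
      exact (isPrimitive_polynomial hle _).hasH1Deriv hle (memLp_polynomial _)
    · rw [h1]
      rintro i' rfl t -
      exact ⟨rfl, rfl⟩
  · set m := T.x j with hm
    have hcm : T.x i.castSucc < m := by
      rw [hm, h1]
      exact T.x_castSucc_lt_succ i
    have hmd : m < T.x i'.succ := by
      rw [hm, h2]
      exact T.x_castSucc_lt_succ i'
    set V : ℝ → ℝ := fun t => if t ≤ m then (P i).eval t else (P i').eval t with hV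
    -- As a sum of indicators the piecewise derivative is square integrable term by term; its value
    -- at `m` is irrelevant.
    set v : ℝ → ℝ := (Iic m).indicator (fun t => (P i).derivative.eval t) +
      (Iic m)ᶜ.indicator (fun t => (P i').derivative.eval t) with hv
    have vl : ∀ t, t ≤ m → v t = (P i).derivative.eval t := fun t ht => by
      simp [hv, ht]
    have vr : ∀ t, m < t → v t = (P i').derivative.eval t := fun t ht => by
      simp [hv, ht]
    have p1 : IsPrimitive (T.x i.castSucc) m V v := by
      refine (isPrimitive_polynomial hcm.le (P i)).congr hcm.le (fun t ht => if_pos ht.2) ?_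
      refine (ae_restrict_iff' measurableSet_Ioo).mpr (Filter.Eventually.of_forall fun t ht => ?_)
      exact vl t ht.2.le
    have p2 : IsPrimitive m (T.x i'.succ) V v := by
      refine (isPrimitive_polynomial hmd.le (P i')).congr hmd.le (fun t ht => ?_) ?_
      · rcases ht.1.eq_or_lt with rfl | h
        · rw [hV, ← hP i i' h1 h2]
          exact if_pos le_rfl
        · exact if_neg h.not_ge
      · refine (ae_restrict_iff' measurableSet_Ioo).mpr
          (Filter.Eventually.of_forall fun t ht => ?_)
        exact vr t ht.1
    refine ⟨V, v, ?_, ?_⟩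
    · rw [h3]
      refine (p1.glue p2 hcm.le).hasH1Deriv (hcm.trans hmd).le ?_
      exact ((memLp_polynomial _).indicator measurableSet_Iic).add
        ((memLp_polynomial _).indicator measurableSet_Iic.compl)
    · intro l hl t ht
      rcases hl with hl | hl
      · have : l = i' := Fin.castSucc_injective _ (hl.symm.trans h2)
        subst this
        have htm : m < t := by
          rw [hm, h2]
          exact ht.1
        exact ⟨if_neg htm.not_ge, vr t htm⟩
      · have : l = i := Fin.succ_injective _ (hl.symm.trans h1)
        subst this
        have htm : t ≤ m := by
          rw [hm, h1]
          exact ht.2.le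
        exact ⟨if_pos htm, vl t htm⟩

/-! ### The local problem on a single element -/

section LocalProblem

variable {c d β : ℝ}

theorem polynomial_eq_of_ae_eq (hcd : c < d) {P Q : ℝ[X]}
    (h : (fun t => P.eval t) =ᵐ[volume.restrict (Ioo c d)] fun t => Q.eval t) : P = Q :=
  Polynomial.eq_of_infinite_eval_eq P Q ((Icc_infinite hcd).mono
    (eqOn_Icc_of_ae_eq_Ioo hcd h P.continuous.continuousOn Q.continuous.continuousOn))

/-- The factor `ψ` raises the degree by at most one and the derivative lowers it again, so `(ψp)'`
is an admissible test function. -/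
theorem natDegree_derivative_mul_le {ψ p : ℝ[X]} {k : ℕ} (hψ : ψ.natDegree ≤ 1)
    (hp : p.natDegree ≤ k) : (derivative (ψ * p)).natDegree ≤ k := by
  have h1 := natDegree_derivative_le (ψ * p)
  have h2 := natDegree_mul_le (p := ψ) (q := p)
  omega

/-- Testing with `(ψp)'` itself shows that `ψp` is constant. The constant is its value at the zero
`z` of `ψ`, namely `0`. -/
theorem eq_zero_of_forall_integral_derivative_mul {ψ p : ℝ[X]} {k : ℕ} {z : ℝ} (hcd : c < d)
    (hβ : β ≠ 0) (hψ : ψ.natDegree ≤ 1) (hψ0 : ψ ≠ 0) (hz : ψ.eval z = 0) (hp : p.natDegree ≤ k)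
    (h : ∀ q : ℝ[X], q.natDegree ≤ k →
      ∫ t in Ioo c d, β * (derivative (ψ * p)).eval t * q.eval t = 0) : p = 0 := by
  have h1 := h _ (natDegree_derivative_mul_le hψ hp)
  simp only [mul_assoc] at h1
  rw [integral_const_mul] at h1
  have h2 := ae_eq_zero_of_integral_mul_self (memLp_polynomial _)
    ((mul_eq_zero.mp h1).resolve_left hβ)
  have h3 : derivative (ψ * p) = 0 := by
    refine polynomial_eq_of_ae_eq hcd (h2.trans ?_)
    simp only [eval_zero]
    rfl
  have h4 := eq_C_of_derivative_eq_zero h3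
  have h5 : (ψ * p).eval z = 0 := by rw [eval_mul, hz, zero_mul]
  rw [h4, eval_C] at h5
  rw [h5, C_0] at h4
  exact (mul_eq_zero.mp h4).resolve_left hψ0

theorem mem_degreeLT_succ_iff {p : ℝ[X]} {k : ℕ} :
    p ∈ degreeLT ℝ (k + 1) ↔ p.natDegree ≤ k := by
  rw [degreeLT_succ_eq_degreeLE, mem_degreeLE, natDegree_le_iff_degree_le]

theorem integrableOn_mul_polynomial {g : ℝ → ℝ} (hg : MemLp g 2 (volume.restrict (Ioo c d)))
    (q : ℝ[X]) : IntegrableOn (fun t => g t * q.eval t) (Ioo c d) :=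
  hg.integrable_mul (memLp_polynomial q)

/-- The local advection problem on one element has a polynomial solution. -/
theorem exists_forall_integral_derivative_mul {ψ : ℝ[X]} {z : ℝ} (hcd : c < d)
    (hβ : β ≠ 0) (hψ : ψ.natDegree ≤ 1) (hψ0 : ψ ≠ 0) (hz : ψ.eval z = 0) (k : ℕ) {G : ℝ → ℝ}
    (hG : MemLp G 2 (volume.restrict (Ioo c d))) :
    ∃ p : ℝ[X], p.natDegree ≤ k ∧ ∀ q : ℝ[X], q.natDegree ≤ k →
      ∫ t in Ioo c d, β * (derivative (ψ * p)).eval t * q.eval t =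
        ∫ t in Ioo c d, G t * q.eval t := by
  have hi : ∀ p q : ℝ[X],
      IntegrableOn (fun t => β * (derivative (ψ * p)).eval t * q.eval t) (Ioo c d) :=
    fun p q => integrableOn_mul_polynomial ((memLp_polynomial _).const_mul β) q
  -- Trial and test space are the same: degree less than `k + 1`, that is, at most `k`. The system
  -- is therefore square, and injectivity gives solvability.
  let L : degreeLT ℝ (k + 1) →ₗ[ℝ] Module.Dual ℝ (degreeLT ℝ (k + 1)) := LinearMap.mk₂ ℝ
    (fun p q => ∫ t in Ioo c d, β * (derivative (ψ * (p : ℝ[X]))).eval t * (q : ℝ[X]).eval t)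
    (fun p p' q => by
      rw [← integral_add (hi _ _) (hi _ _)]
      congr 1
      ext t
      simp only [Submodule.coe_add, mul_add, derivative_add, eval_add]
      ring)
    (fun r p q => by
      rw [smul_eq_mul, ← integral_const_mul]
      congr 1
      ext t
      simp only [Submodule.coe_smul, mul_smul_comm, derivative_smul, eval_smul, smul_eq_mul]
      ring)
    (fun p q q' => by
      rw [← integral_add (hi _ _) (hi _ _)]
      congr 1
      ext t
      simp only [Submodule.coe_add, eval_add]
      ring)
    (fun r p q => by
      rw [smul_eq_mul, ← integral_const_mul]
      congr 1
      ext t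
      simp only [Submodule.coe_smul, eval_smul, smul_eq_mul]
      ring)
  let M : Module.Dual ℝ (degreeLT ℝ (k + 1)) :=
    { toFun := fun q => ∫ t in Ioo c d, G t * (q : ℝ[X]).eval t
      map_add' := fun q q' => by
        rw [← integral_add (integrableOn_mul_polynomial hG _) (integrableOn_mul_polynomial hG _)]
        congr 1
        ext t
        simp only [Submodule.coe_add, eval_add]
        ring
      map_smul' := fun r q => by
        rw [RingHom.id_apply, smul_eq_mul, ← integral_const_mul]
        congr 1
        ext t
        simp only [Submodule.coe_smul, eval_smul, smul_eq_mul]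
        ring }
  have hinj : Function.Injective L := by
    rw [← LinearMap.ker_eq_bot, LinearMap.ker_eq_bot']
    intro p hp
    apply Subtype.ext
    refine eq_zero_of_forall_integral_derivative_mul hcd hβ hψ hψ0 hz
      (mem_degreeLT_succ_iff.mp p.2) fun q hq => ?_
    exact LinearMap.congr_fun hp ⟨q, mem_degreeLT_succ_iff.mpr hq⟩
  have hsurj : Function.Surjective L :=
    (LinearMap.injective_iff_surjective_of_finrank_eq_finrank
      Subspace.dual_finrank_eq.symm).mp hinj
  obtain ⟨p, hp⟩ := hsurj M
  refine ⟨p, mem_degreeLT_succ_iff.mp p.2, fun q hq => ?_⟩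
  exact LinearMap.congr_fun hp ⟨q, mem_degreeLT_succ_iff.mpr hq⟩

theorem memLp_mul_polynomial {g : ℝ → ℝ} (hg : MemLp g 2 (volume.restrict (Ioo c d)))
    (q : ℝ[X]) : MemLp (fun t => g t * q.eval t) 2 (volume.restrict (Ioo c d)) := by
  obtain ⟨K, hK⟩ := isCompact_Icc.exists_bound_of_continuousOn (s := Icc c d)
    q.continuous.continuousOn
  refine hg.of_le_mul (c := K)
    (hg.aestronglyMeasurable.mul q.continuous.aestronglyMeasurable) ?_
  refine (ae_restrict_iff' measurableSet_Ioo).mpr (Filter.Eventually.of_forall fun t ht => ?_)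
  rw [norm_mul, mul_comm]
  exact mul_le_mul_of_nonneg_right (hK t (Ioo_subset_Icc_self ht)) (norm_nonneg _)

theorem setIntegral_mul_indicator {E S : Set ℝ} (hE : E ⊆ S) (hEm : MeasurableSet E)
    (F g : ℝ → ℝ) : ∫ t in S, F t * E.indicator g t = ∫ t in E, F t * g t := by
  have : (fun t => F t * E.indicator g t) = E.indicator fun t => F t * g t := by
    ext t
    by_cases ht : t ∈ E <;> simp [ht]
  rw [this, setIntegral_indicator hEm, inter_eq_right.mpr hE]

end LocalProblem

/-! ### Local problems on patches, assembled from their elements -/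

namespace Mesh

variable {a b β : ℝ} (T : Mesh a b)

theorem hatPoly_ne_zero {i : Fin T.n} {j : Fin (T.n + 1)} (h : i ∈ T.star j) :
    T.hatPoly i j ≠ 0 := by
  intro h0
  have := T.eval_hatPoly_self h
  rw [h0, eval_zero] at this
  exact zero_ne_one this

theorem exists_eval_hatPoly_eq_zero {i : Fin T.n} {j : Fin (T.n + 1)} (h : i ∈ T.star j) :
    ∃ z, (T.hatPoly i j).eval z = 0 := by
  rcases h with rfl | rfl
  · exact ⟨_, T.eval_hatPoly_castSucc_succ i⟩
  · exact ⟨_, T.eval_hatPoly_succ_castSucc i⟩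

theorem memLp_of_forall_elem {S : Set ℝ} (hS : S ⊆ Ioo a b) (hSm : MeasurableSet S) {g : ℝ → ℝ}
    (h : ∀ i, MemLp g 2 (volume.restrict (T.elem i ∩ S))) : MemLp g 2 (volume.restrict S) := by
  have hsum : MemLp (fun t => ∑ i, (T.elem i).indicator g t) 2 (volume.restrict S) := by
    refine memLp_finsetSum _ fun i _ => ?_
    rw [memLp_indicator_iff_restrict (T.measurableSet_elem i),
      Measure.restrict_restrict (T.measurableSet_elem i)]
    exact h i
  refine (memLp_congr_ae ?_).mp hsum
  refine (ae_restrict_iff' hSm).mpr ?_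
  filter_upwards [T.ae_exists_mem_elem] with t ht htS
  obtain ⟨i, hi⟩ := ht (hS htS)
  rw [Finset.sum_eq_single i, indicator_of_mem hi]
  · intro l _ hl
    exact indicator_of_notMem (Set.disjoint_left.mp (T.disjoint_elem hl.symm) hi) _
  · simp

theorem memLp_Ioo {g : ℝ → ℝ} (h : ∀ i, MemLp g 2 (volume.restrict (T.elem i))) :
    MemLp g 2 (volume.restrict (Ioo a b)) :=
  T.memLp_of_forall_elem subset_rfl measurableSet_Ioo fun i => by
    rw [inter_eq_left.mpr (T.elem_subset i)]
    exact h i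

theorem memLp_patch {g : ℝ → ℝ} {j : Fin (T.n + 1)}
    (h : ∀ i ∈ T.star j, MemLp g 2 (volume.restrict (T.elem i))) :
    MemLp g 2 (volume.restrict (T.patch j)) := by
  refine T.memLp_of_forall_elem (T.patch_subset j) measurableSet_Ioo fun i => ?_
  by_cases hi : i ∈ T.star j
  · rw [inter_eq_left.mpr (T.elem_subset_patch hi)]
    exact h i hi
  · have : T.elem i ∩ T.patch j = ∅ :=
      eq_empty_of_forall_notMem fun t ht => hi (T.mem_star_of_mem ht.1 ht.2)
    simp [this]

theorem memLp_elem (f : L2 (Ioo a b)) (i : Fin T.n) : MemLp f 2 (volume.restrict (T.elem i)) :=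
  (Lp.memLp f).mono_measure (Measure.restrict_mono (T.elem_subset i) le_rfl)

theorem memLp_mul_hat (f : L2 (Ioo a b)) (j : Fin (T.n + 1)) :
    MemLp (fun t => f t * T.hat j t) 2 (volume.restrict (Ioo a b)) :=
  T.memLp_Ioo fun i => by
    refine (memLp_congr_ae ?_).mp (memLp_mul_polynomial (T.memLp_elem f i) (T.hatPoly i j))
    refine (ae_restrict_iff' measurableSet_Ioo).mpr (Filter.Eventually.of_forall fun t ht => ?_)
    simp only [T.hat_eq_eval ht]

theorem memLp_mul_deriv_hat (f : L2 (Ioo a b)) (j : Fin (T.n + 1)) :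
    MemLp (fun t => f t * deriv (T.hat j) t) 2 (volume.restrict (Ioo a b)) :=
  T.memLp_Ioo fun i => by
    refine (memLp_congr_ae ?_).mp
      (memLp_mul_polynomial (T.memLp_elem f i) (T.hatPoly i j).derivative)
    refine (ae_restrict_iff' measurableSet_Ioo).mpr (Filter.Eventually.of_forall fun t ht => ?_)
    simp only [T.deriv_hat_eq_eval ht]

/-- The right-hand side `f ψ + β ψ' uh` of the local problem at the vertex `j`. -/
def localRhs (β : ℝ) (f uh : L2 (Ioo a b)) (j : Fin (T.n + 1)) (t : ℝ) : ℝ :=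
  f t * T.hat j t + β * deriv (T.hat j) t * uh t

variable {f uh : L2 (Ioo a b)}

theorem memLp_localRhs (j : Fin (T.n + 1)) :
    MemLp (T.localRhs β f uh j) 2 (volume.restrict (Ioo a b)) := by
  refine (memLp_congr_ae (Filter.Eventually.of_forall fun t => ?_)).mp
    ((T.memLp_mul_hat f j).add ((T.memLp_mul_deriv_hat uh j).const_mul β))
  simp only [localRhs, Pi.add_apply]
  ring

theorem memLp_localRhs_elem (i : Fin T.n) (j : Fin (T.n + 1)) :
    MemLp (T.localRhs β f uh j) 2 (volume.restrict (T.elem i)) :=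
  (T.memLp_localRhs j).mono_measure (Measure.restrict_mono (T.elem_subset i) le_rfl)

theorem residual_hat_eq_sum (j : Fin (T.n + 1)) :
    residual a b β f uh (T.hat j) (deriv (T.hat j)) =
      ∑ i, ∫ t in T.elem i, T.localRhs β f uh j t := by
  have i1 : IntegrableOn (fun t => f t * T.hat j t) (Ioo a b) :=
    (T.memLp_mul_hat f j).integrable (by norm_num)
  have i2 : IntegrableOn (fun t => uh t * (β * deriv (T.hat j) t)) (Ioo a b) := by
    refine (((T.memLp_mul_deriv_hat uh j).const_mul β).integrable (by norm_num)).congr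
      (Filter.Eventually.of_forall fun t => ?_)
    ring
  rw [residual, ← integral_add i1 i2,
    ← T.setIntegral_Ioo_eq_sum ((T.memLp_localRhs j).integrable (by norm_num))]
  congr 1
  ext t
  simp only [localRhs]
  ring

theorem localRhs_eq_zero {i : Fin T.n} {j : Fin (T.n + 1)} (h : i ∉ T.star j) {t : ℝ}
    (ht : t ∈ T.elem i) : T.localRhs β f uh j t = 0 := by
  rw [localRhs, T.hat_eq_eval ht, T.deriv_hat_eq_eval ht, T.hatPoly_of_notMem h]
  simp

theorem setIntegral_localRhs_eq_zero {i : Fin T.n} {j : Fin (T.n + 1)} (h : i ∉ T.star j) :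
    ∫ t in T.elem i, T.localRhs β f uh j t = 0 :=
  setIntegral_eq_zero_of_forall_eq_zero fun _ ht => T.localRhs_eq_zero h ht

/-- On the `i`-th element, the polynomial `p` of degree at most `k` solves the local problem of the
vertex `j`. -/
def SolvesOn (β : ℝ) (f uh : L2 (Ioo a b)) (k : ℕ) (i : Fin T.n) (j : Fin (T.n + 1))
    (p : ℝ[X]) : Prop :=
  p.natDegree ≤ k ∧ ∀ q : ℝ[X], q.natDegree ≤ k →
    ∫ t in T.elem i, β * (derivative (T.hatPoly i j * p)).eval t * q.eval t =
      ∫ t in T.elem i, T.localRhs β f uh j t * q.eval t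

variable {k : ℕ} {i : Fin T.n} {j : Fin (T.n + 1)} {p p' : ℝ[X]}

theorem exists_solvesOn (hβ : β ≠ 0) (h : i ∈ T.star j) : ∃ p, T.SolvesOn β f uh k i j p := by
  obtain ⟨z, hz⟩ := T.exists_eval_hatPoly_eq_zero h
  exact exists_forall_integral_derivative_mul (T.x_castSucc_lt_succ i) hβ
    (T.natDegree_hatPoly_le i j) (T.hatPoly_ne_zero h) hz k (T.memLp_localRhs_elem i j)

variable {T}

theorem SolvesOn.unique (hβ : β ≠ 0) (h : i ∈ T.star j) (hp : T.SolvesOn β f uh k i j p)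
    (hp' : T.SolvesOn β f uh k i j p') : p = p' := by
  obtain ⟨z, hz⟩ := T.exists_eval_hatPoly_eq_zero h
  rw [← sub_eq_zero]
  refine eq_zero_of_forall_integral_derivative_mul (T.x_castSucc_lt_succ i) hβ
    (T.natDegree_hatPoly_le i j) (T.hatPoly_ne_zero h) hz
    ((natDegree_sub_le p p').trans (max_le hp.1 hp'.1)) fun q hq => ?_
  have i1 := integrableOn_mul_polynomial (c := T.x i.castSucc) (d := T.x i.succ)
    ((memLp_polynomial (derivative (T.hatPoly i j * p))).const_mul β) q
  have i2 := integrableOn_mul_polynomial (c := T.x i.castSucc) (d := T.x i.succ)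
    ((memLp_polynomial (derivative (T.hatPoly i j * p'))).const_mul β) q
  have e := (hp.2 q hq).trans (hp'.2 q hq).symm
  rw [elem, ← sub_eq_zero, ← integral_sub i1 i2] at e
  rw [← e]
  congr 1
  ext t
  simp only [mul_sub, derivative_sub, eval_sub]
  ring

theorem integral_elem_derivative (i : Fin T.n) (P : ℝ[X]) :
    ∫ t in T.elem i, (derivative P).eval t = P.eval (T.x i.succ) - P.eval (T.x i.castSucc) := by
  have hle := (T.x_castSucc_lt_succ i).le
  have := (isPrimitive_polynomial hle P).2 _ ⟨hle, le_rfl⟩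
  rw [elem, ← integral_eq_setIntegral_Ioo hle]
  linarith

/-- The test function `1` is allowed for every `k ≥ 0`; it turns the local equation into a balance
of end point values. -/
theorem SolvesOn.integral_localRhs (hp : T.SolvesOn β f uh k i j p) :
    ∫ t in T.elem i, T.localRhs β f uh j t =
      β * ((T.hatPoly i j * p).eval (T.x i.succ) - (T.hatPoly i j * p).eval (T.x i.castSucc)) := by
  have h := hp.2 1 (by simp)
  simp only [eval_one, mul_one] at h
  rw [← h, integral_const_mul, integral_elem_derivative]

theorem SolvesOn.integral_localRhs_castSucc (hp : T.SolvesOn β f uh k i i.castSucc p) :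
    ∫ t in T.elem i, T.localRhs β f uh i.castSucc t = -(β * p.eval (T.x i.castSucc)) := by
  rw [hp.integral_localRhs, eval_mul, eval_mul, eval_hatPoly_castSucc_succ,
    T.eval_hatPoly_self (Or.inl rfl)]
  ring

theorem SolvesOn.integral_localRhs_succ (hp : T.SolvesOn β f uh k i i.succ p) :
    ∫ t in T.elem i, T.localRhs β f uh i.succ t = β * p.eval (T.x i.succ) := by
  rw [hp.integral_localRhs, eval_mul, eval_mul, eval_hatPoly_succ_castSucc,
    T.eval_hatPoly_self (Or.inr rfl)]
  ring

theorem x_mem_Ioo {i i' : Fin T.n} (h1 : j = i.succ) (h2 : j = i'.castSucc) :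
    T.x j ∈ Ioo a b := by
  have h3 : T.x 0 < T.x j := T.strictMono (h1 ▸ Fin.succ_pos i)
  have h4 : T.x j < T.x (Fin.last T.n) := T.strictMono (h2 ▸ Fin.castSucc_lt_last i')
  rw [T.left_eq] at h3
  rw [T.right_eq] at h4
  exact ⟨h3, h4⟩

/-- At an interior vertex the local solutions on both sides have the same value. -/
theorem SolvesOn.eval_eq_eval (hβ : β ≠ 0) (horth : T.HatOrthogonal β f uh) {i' : Fin T.n}
    (h1 : j = i.succ) (h2 : j = i'.castSucc) (hp : T.SolvesOn β f uh k i j p)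
    (hp' : T.SolvesOn β f uh k i' j p') : p.eval (T.x j) = p'.eval (T.x j) := by
  have h := horth j (Or.inl (x_mem_Ioo h1 h2))
  have hne : i ≠ i' := by
    rintro rfl
    exact Fin.castSucc_lt_succ.ne' (h1.symm.trans h2)
  -- Only the two elements at the vertex contribute. Their integrals have opposite signs, so a zero
  -- residual is equality of the one-sided values.
  rw [residual_hat_eq_sum, Finset.sum_eq_add i i' hne (fun l _ hl =>
    T.setIntegral_localRhs_eq_zero fun hl' => ?_) (by simp) (by simp)] at h
  · have e1 : ∫ t in T.elem i, T.localRhs β f uh j t = β * p.eval (T.x j) := by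
      subst h1
      exact hp.integral_localRhs_succ
    have e2 : ∫ t in T.elem i', T.localRhs β f uh j t = -(β * p'.eval (T.x j)) := by
      subst h2
      exact hp'.integral_localRhs_castSucc
    rw [e1, e2, ← sub_eq_add_neg, ← mul_sub] at h
    exact sub_eq_zero.mp ((mul_eq_zero.mp h).resolve_left hβ)
  · rcases hl' with h' | h'
    · exact hl.2 (Fin.castSucc_injective _ (h'.symm.trans h2))
    · exact hl.1 (Fin.succ_injective _ (h'.symm.trans h1))

theorem eq_zero_or_eq_last_of_mem_inflow (hj : T.x j ∈ inflow a b β) :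
    j = 0 ∨ j = Fin.last T.n := by
  rcases hj.1 with h | h
  · exact Or.inl (T.strictMono.injective (h.trans T.left_eq.symm))
  · exact Or.inr (T.strictMono.injective (h.trans T.right_eq.symm))

/-- The local solutions vanish at the inflow boundary. -/
theorem SolvesOn.eval_eq_zero (hβ : β ≠ 0) (horth : T.HatOrthogonal β f uh)
    (hj : T.x j ∈ inflow a b β) (hi : i ∈ T.star j) (hp : T.SolvesOn β f uh k i j p) :
    p.eval (T.x j) = 0 := by
  have h := horth j (Or.inr hj)
  have hj' := eq_zero_or_eq_last_of_mem_inflow hj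
  rw [residual_hat_eq_sum, Finset.sum_eq_single i (fun l _ hl =>
    T.setIntegral_localRhs_eq_zero fun hl' => hl ?_) (by simp)] at h
  · rcases hi with rfl | rfl
    · rw [hp.integral_localRhs_castSucc] at h
      exact (mul_eq_zero.mp (neg_eq_zero.mp h)).resolve_left hβ
    · rw [hp.integral_localRhs_succ] at h
      exact (mul_eq_zero.mp h).resolve_left hβ
  -- An inflow vertex is an end vertex, hence belongs to only one element.
  · simp only [star, mem_ofPred_eq, Fin.ext_iff, Fin.val_castSucc, Fin.val_succ, Fin.val_zero,
      Fin.val_last] at hi hl' hj' ⊢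
    omega

/-- Local solutions are elementwise polynomial solutions. -/
theorem IsLocalSolution.exists_solvesOn {s : L2 (T.patch j)}
    (hs : T.IsLocalSolution β f uh k j s) (hi : i ∈ T.star j) :
    ∃ p, T.SolvesOn β f uh k i j p ∧ s =ᵐ[volume.restrict (T.elem i)] fun t => p.eval t := by
  obtain ⟨hpoly, -, d, hd, heq⟩ := hs
  obtain ⟨p, hp, hsp⟩ := hpoly i hi
  have hsub := T.elem_subset_patch hi
  have hle := (T.x_castSucc_lt_succ i).le
  refine ⟨p, ⟨hp, fun q hq => ?_⟩, hsp⟩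
  have hψs : (fun t => (T.hatPoly i j * p).eval t) =ᵐ[volume.restrict (T.elem i)]
      fun t => T.hat j t * s t := by
    filter_upwards [hsp, ae_restrict_mem (T.measurableSet_elem i)] with t h1 h2
    rw [h1, T.hat_eq_eval h2, eval_mul]
  -- On one element `ψ s` is a polynomial, so by uniqueness its weak derivative is the classical
  -- one.
  have hd' : d =ᵐ[volume.restrict (T.elem i)] fun t => (derivative (T.hatPoly i j * p)).eval t :=
    ((hd.mono hsub measurableSet_Ioo).congr hψs Filter.EventuallyEq.rfl).unique
      ((isPrimitive_polynomial hle _).hasH1Deriv hle (memLp_polynomial _))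
  -- Test functions need not be continuous, so a polynomial cut off to one element is allowed. This
  -- decouples the elements.
  have h := heq ((T.elem i).indicator fun t => q.eval t) (by
    intro l _
    by_cases hl : l = i
    · subst hl
      refine ⟨q, hq, ?_⟩
      filter_upwards [ae_restrict_mem (T.measurableSet_elem l)] with t ht
      exact indicator_of_mem ht _
    · refine ⟨0, by simp, ?_⟩
      filter_upwards [ae_restrict_mem (T.measurableSet_elem l)] with t ht
      rw [eval_zero]
      exact indicator_of_notMem (Set.disjoint_left.mp (T.disjoint_elem hl) ht) _)
  rw [setIntegral_mul_indicator hsub (T.measurableSet_elem i),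
    setIntegral_mul_indicator hsub (T.measurableSet_elem i)] at h
  refine Eq.trans (integral_congr_ae ?_) h
  filter_upwards [hd'] with t ht
  rw [ht]

/-- Elementwise polynomial solutions give a solution of the local problem. -/
theorem exists_isLocalSolution (hab : a < b) (hβ : β ≠ 0) (horth : T.HatOrthogonal β f uh) (k : ℕ)
    (j : Fin (T.n + 1)) : ∃ s : L2 (T.patch j), T.IsLocalSolution β f uh k j s := by
  have hex : ∀ i, ∃ p, i ∈ T.star j → T.SolvesOn β f uh k i j p := fun i => by
    by_cases hi : i ∈ T.star j
    · obtain ⟨p, hp⟩ := T.exists_solvesOn (f := f) (uh := uh) (k := k) hβ hi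
      exact ⟨p, fun _ => hp⟩
    · exact ⟨0, fun h => absurd h hi⟩
  choose p hp using hex
  -- The condition is vacuous at both end vertices; at interior ones it comes from orthogonality to
  -- the hat function.
  have hmatch : ∀ i i', j = i.succ → j = i'.castSucc →
      (p i).eval (T.x j) = (p i').eval (T.x j) := fun i i' h1 h2 =>
    SolvesOn.eval_eq_eval hβ horth h1 h2 (hp i (Or.inr h1)) (hp i' (Or.inl h2))
  obtain ⟨V, v, hV, hVp⟩ := T.exists_hasH1Deriv_patch hab j p hmatch
  obtain ⟨W, w, hW, hWp⟩ := T.exists_hasH1Deriv_patch hab j (fun i => T.hatPoly i j * p i)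
    (fun i i' h1 h2 => by
      rw [eval_mul, eval_mul, T.eval_hatPoly_self (Or.inr h1), T.eval_hatPoly_self (Or.inl h2),
        hmatch i i' h1 h2])
  have hs : hV.1.toLp V =ᵐ[volume.restrict (T.patch j)] V := hV.1.coeFn_toLp
  refine ⟨hV.1.toLp V, fun i hi => ⟨p i, (hp i hi).1, ?_⟩,
    ⟨v, hV.congr hs Filter.EventuallyEq.rfl⟩, w, hW.congr ?_ Filter.EventuallyEq.rfl, ?_⟩
  · filter_upwards [ae_restrict_of_ae_restrict_of_subset (T.elem_subset_patch hi) hs,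
      ae_restrict_mem (T.measurableSet_elem i)] with t h1 h2
    rw [h1, (hVp i hi t h2).1]
  · refine T.ae_restrict_patch fun i hi => ?_
    filter_upwards [ae_restrict_of_ae_restrict_of_subset (T.elem_subset_patch hi) hs,
      ae_restrict_mem (T.measurableSet_elem i)] with t h1 h2
    rw [h1, (hVp i hi t h2).1, (hWp i hi t h2).1, T.hat_eq_eval h2, eval_mul]
  · intro g hg
    have hgm : MemLp g 2 (volume.restrict (T.patch j)) := T.memLp_patch fun i hi => by
      obtain ⟨q, -, hq⟩ := hg i hi
      exact (memLp_congr_ae hq).mpr (memLp_polynomial q)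
    have hrm : MemLp (T.localRhs β f uh j) 2 (volume.restrict (T.patch j)) :=
      (T.memLp_localRhs j).mono_measure (Measure.restrict_mono (T.patch_subset j) le_rfl)
    refine T.setIntegral_patch_congr ((hW.2.1.const_mul β).integrable_mul hgm)
      (hrm.integrable_mul hgm) fun i hi => ?_
    obtain ⟨q, hq, hgq⟩ := hg i hi
    refine Eq.trans (integral_congr_ae ?_) (((hp i hi).2 q hq).trans (integral_congr_ae ?_))
    · filter_upwards [hgq, ae_restrict_mem (T.measurableSet_elem i)] with t h1 h2
      rw [h1, (hWp i hi t h2).2]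
    · filter_upwards [hgq] with t h1
      rw [h1, localRhs]

theorem IsLocalSolution.unique (hβ : β ≠ 0) {s s' : L2 (T.patch j)}
    (hs : T.IsLocalSolution β f uh k j s) (hs' : T.IsLocalSolution β f uh k j s') : s = s' := by
  apply Lp.ext
  refine T.ae_restrict_patch fun i hi => ?_
  obtain ⟨p, hp, hsp⟩ := hs.exists_solvesOn hi
  obtain ⟨p', hp', hsp'⟩ := hs'.exists_solvesOn hi
  obtain rfl := hp.unique hβ hi hp'
  exact hsp.trans hsp'.symm

end Mesh

/-! ### The norm on subdomains -/

section NormOn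

variable {D : Set ℝ} {g g' : ℝ → ℝ}

theorem normOn_nonneg (D : Set ℝ) (g : ℝ → ℝ) : 0 ≤ normOn D g := Real.sqrt_nonneg _

theorem normOn_sq (D : Set ℝ) (g : ℝ → ℝ) : normOn D g ^ 2 = ∫ t in D, g t * g t :=
  Real.sq_sqrt (integral_nonneg fun t => mul_self_nonneg (g t))

theorem normOn_congr (h : g =ᵐ[volume.restrict D] g') : normOn D g = normOn D g' := by
  unfold normOn
  congr 1
  refine integral_congr_ae ?_
  filter_upwards [h] with t ht
  rw [ht]

theorem norm_eq_normOn (u : L2 D) : ‖u‖ = normOn D u := by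
  rw [norm_eq_sqrt_real_inner, L2.inner_def]
  rfl

theorem norm_toLp_eq_normOn (hg : MemLp g 2 (volume.restrict D)) : ‖hg.toLp g‖ = normOn D g := by
  rw [norm_eq_normOn]
  exact normOn_congr hg.coeFn_toLp

theorem normOn_sub_le (hg : MemLp g 2 (volume.restrict D))
    (hg' : MemLp g' 2 (volume.restrict D)) :
    normOn D (fun t => g t - g' t) ≤ normOn D g + normOn D g' := by
  rw [← norm_toLp_eq_normOn hg, ← norm_toLp_eq_normOn hg']
  refine le_trans (le_of_eq ?_) (norm_sub_le _ _)
  rw [← MemLp.toLp_sub, norm_toLp_eq_normOn]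
  rfl

end NormOn

/-! ### The reconstruction and the error estimate -/

namespace Mesh

variable {a b β : ℝ} {T : Mesh a b} {f uh : L2 (Ioo a b)} {k : ℕ}

theorem norm_eq_sqrt_sum (T : Mesh a b) (u : L2 (Ioo a b)) :
    ‖u‖ = Real.sqrt (∑ i, normOn (T.elem i) u ^ 2) := by
  rw [norm_eq_normOn, normOn]
  congr 1
  simp only [normOn_sq]
  exact T.setIntegral_Ioo_eq_sum ((Lp.memLp u).integrable_mul (Lp.memLp u))

/-- The polynomial that agrees with the `L²` projection of `f` on the `i`-th element. -/
theorem exists_starProjection_eq (T : Mesh a b) (f : L2 (Ioo a b)) (k : ℕ) (i : Fin T.n) :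
    ∃ r : ℝ[X], r.natDegree ≤ k ∧
      (T.polySpace k).starProjection f =ᵐ[volume.restrict (T.elem i)] (fun t => r.eval t) ∧
      ∀ q : ℝ[X], q.natDegree ≤ k →
        ∫ t in T.elem i, f t * q.eval t = ∫ t in T.elem i, r.eval t * q.eval t := by
  obtain ⟨r, hr, hfr⟩ := (T.polySpace k).starProjection_apply_mem f i (mem_univ i)
  refine ⟨r, hr, hfr, fun q hq => ?_⟩
  have hm : MemLp ((T.elem i).indicator fun t => q.eval t) 2 (volume.restrict (Ioo a b)) :=
    (memLp_polynomial q).indicator (T.measurableSet_elem i)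
  have hsub := T.elem_subset i
  have hmem : hm.toLp _ ∈ T.polySpace k := by
    intro l _
    have h := ae_restrict_of_ae_restrict_of_subset (T.elem_subset l) hm.coeFn_toLp
    by_cases hl : l = i
    · subst hl
      refine ⟨q, hq, ?_⟩
      filter_upwards [h, ae_restrict_mem (T.measurableSet_elem l)] with t h1 ht
      rw [h1, indicator_of_mem ht]
    · refine ⟨0, by simp, ?_⟩
      filter_upwards [h, ae_restrict_mem (T.measurableSet_elem l)] with t h1 ht
      rw [h1, eval_zero]
      exact indicator_of_notMem (Set.disjoint_left.mp (T.disjoint_elem hl) ht) _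
  have h0 := (T.polySpace k).starProjection_inner_eq_zero f _ hmem
  rw [L2.inner_def] at h0
  have h1 : ∫ t in Ioo a b, (f t - (T.polySpace k).starProjection f t) *
      (T.elem i).indicator (fun t => q.eval t) t = 0 := by
    rw [← h0]
    refine integral_congr_ae ?_
    filter_upwards [hm.coeFn_toLp, Lp.coeFn_sub f ((T.polySpace k).starProjection f)] with t h2 h3
    rw [h2, h3]
    simp [mul_comm]
  rw [setIntegral_mul_indicator hsub (T.measurableSet_elem i)] at h1
  have i1 := integrableOn_mul_polynomial (T.memLp_elem f i) q
  have i2 := integrableOn_mul_polynomial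
    (memLp_polynomial (c := T.x i.castSucc) (d := T.x i.succ) r) q
  rw [← sub_eq_zero, elem, ← integral_sub i1 i2, ← h1]
  refine integral_congr_ae ?_
  filter_upwards [hfr] with t ht
  rw [ht]
  ring

/-- On each element, `β` times the derivative of the reconstruction is the `L²` projection of
`f`. -/
theorem SolvesOn.derivative_eq {i : Fin T.n} {p₀ p₁ r : ℝ[X]}
    (h₀ : T.SolvesOn β f uh k i i.castSucc p₀) (h₁ : T.SolvesOn β f uh k i i.succ p₁)
    (hr : r.natDegree ≤ k) (hfr : ∀ q : ℝ[X], q.natDegree ≤ k →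
      ∫ t in T.elem i, f t * q.eval t = ∫ t in T.elem i, r.eval t * q.eval t) :
    C β * derivative (T.hatPoly i i.castSucc * p₀ + T.hatPoly i i.succ * p₁) = r := by
  set P₀ := T.hatPoly i i.castSucc * p₀
  set P₁ := T.hatPoly i i.succ * p₁
  have hlt := T.x_castSucc_lt_succ i
  -- The difference of the two sides has degree at most `k`, so it may be tested with itself below.
  have hdeg : (C β * derivative (P₀ + P₁) - r).natDegree ≤ k := by
    refine (natDegree_sub_le _ _).trans (max_le ((natDegree_C_mul_le _ _).trans ?_) hr)
    rw [derivative_add]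
    exact (natDegree_add_le _ _).trans (max_le
      (natDegree_derivative_mul_le (T.natDegree_hatPoly_le _ _) h₀.1)
      (natDegree_derivative_mul_le (T.natDegree_hatPoly_le _ _) h₁.1))
  have horth : ∀ q : ℝ[X], q.natDegree ≤ k →
      ∫ t in T.elem i, (C β * derivative (P₀ + P₁) - r).eval t * q.eval t = 0 := by
    intro q hq
    have i0 := integrableOn_mul_polynomial (c := T.x i.castSucc) (d := T.x i.succ)
      ((memLp_polynomial (derivative P₀)).const_mul β) q
    have i1 := integrableOn_mul_polynomial (c := T.x i.castSucc) (d := T.x i.succ)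
      ((memLp_polynomial (derivative P₁)).const_mul β) q
    have ir := integrableOn_mul_polynomial (c := T.x i.castSucc) (d := T.x i.succ)
      (memLp_polynomial r) q
    have j0 := integrableOn_mul_polynomial
      (T.memLp_localRhs_elem (β := β) (f := f) (uh := uh) i i.castSucc) q
    have j1 := integrableOn_mul_polynomial
      (T.memLp_localRhs_elem (β := β) (f := f) (uh := uh) i i.succ) q
    have e1 : ∫ t in T.elem i, (C β * derivative (P₀ + P₁) - r).eval t * q.eval t =
        (∫ t in T.elem i, β * (derivative P₀).eval t * q.eval t) +
          (∫ t in T.elem i, β * (derivative P₁).eval t * q.eval t) -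
            ∫ t in T.elem i, r.eval t * q.eval t := by
      have i01 : IntegrableOn (fun t => β * (derivative P₀).eval t * q.eval t +
          β * (derivative P₁).eval t * q.eval t) (Ioo (T.x i.castSucc) (T.x i.succ)) := i0.add i1
      rw [elem, ← integral_add i0 i1, ← integral_sub i01 ir]
      congr 1
      ext t
      simp only [derivative_add, eval_sub, eval_mul, eval_C, eval_add]
      ring
    have e2 : (∫ t in T.elem i, T.localRhs β f uh i.castSucc t * q.eval t) +
        (∫ t in T.elem i, T.localRhs β f uh i.succ t * q.eval t) =
          ∫ t in T.elem i, f t * q.eval t := by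
      rw [elem, ← integral_add j0 j1]
      refine setIntegral_congr_fun measurableSet_Ioo fun t ht => ?_
      -- The hat functions sum to one and their derivatives to zero: `f` survives and `uh` drops
      -- out.
      have s1 := T.hatPoly_castSucc_add_succ i
      have s2 := congrArg (fun P => (derivative P).eval t) s1
      have s3 := congrArg (fun P => P.eval t) s1
      simp only [derivative_add, eval_add, derivative_one, eval_zero, eval_one] at s2 s3
      simp only [localRhs, T.hat_eq_eval (i := i) ht, T.deriv_hat_eq_eval (i := i) ht]
      linear_combination (f t * q.eval t) * s3 + (β * uh t * q.eval t) * s2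
    rw [e1, h₀.2 q hq, h₁.2 q hq, e2, hfr q hq, sub_self]
  have h := ae_eq_zero_of_integral_mul_self (memLp_polynomial _) (horth _ hdeg)
  rw [← sub_eq_zero]
  refine polynomial_eq_of_ae_eq hlt (h.trans ?_)
  simp only [eval_zero]
  rfl

/-- A function on the elements that does not jump at interior vertices is constant. -/
theorem eq_of_forall_succ_eq_castSucc {n : ℕ} {δ : Fin n → ℝ}
    (h : ∀ i i' : Fin n, i.succ = i'.castSucc → δ i = δ i') (i i' : Fin n) : δ i = δ i' := by
  have key : ∀ m (hm : m < n), δ ⟨m, hm⟩ = δ ⟨0, by omega⟩ := by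
    intro m
    induction m with
    | zero => exact fun _ => rfl
    | succ m ih =>
      intro hm
      rw [← ih (by omega)]
      exact (h ⟨m, by omega⟩ ⟨m + 1, hm⟩ (Fin.ext (by simp))).symm
  exact (key i i.2).trans (key i' i'.2).symm

theorem exists_mem_star_inflow (T : Mesh a b) (hab : a < b) (hβ : β ≠ 0) :
    ∃ i j, T.x j ∈ inflow a b β ∧ i ∈ T.star j := by
  obtain ⟨e, o, he, -, heo⟩ := exists_inflow_outflow hab hβ
  have hj : ∃ j, T.x j = e := by
    rcases heo with ⟨rfl, -⟩ | ⟨rfl, -⟩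
    · exact ⟨0, T.left_eq⟩
    · exact ⟨Fin.last T.n, T.right_eq⟩
  obtain ⟨j, hj⟩ := hj
  rcases T.patch_cases hab j with ⟨i, hi, -⟩ | ⟨i, i', hi, -⟩
  · exact ⟨i, j, by rw [hj, he]; rfl, by rw [hi]; rfl⟩
  · exact ⟨i, j, by rw [hj, he]; rfl, Or.inr hi⟩

theorem x_mem_Icc (T : Mesh a b) (j : Fin (T.n + 1)) : T.x j ∈ Icc a b :=
  ⟨T.left_eq.symm.le.trans (T.strictMono.monotone (Fin.zero_le _)),
    (T.strictMono.monotone (Fin.le_last _)).trans T.right_eq.le⟩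

theorem isPrimitive_elem {U v : ℝ → ℝ} (hU : IsPrimitive a b U v) (i : Fin T.n) :
    IsPrimitive (T.x i.castSucc) (T.x i.succ) U v :=
  hU.mono (T.x_mem_Icc _).1 (T.x_castSucc_lt_succ i).le (T.x_mem_Icc _).2

theorem eval_castSucc (i : Fin T.n) (p₀ p₁ : ℝ[X]) :
    (T.hatPoly i i.castSucc * p₀ + T.hatPoly i i.succ * p₁).eval (T.x i.castSucc) =
      p₀.eval (T.x i.castSucc) := by
  rw [eval_add, eval_mul, eval_mul, eval_hatPoly_succ_castSucc, T.eval_hatPoly_self (Or.inl rfl)]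
  ring

theorem eval_succ (i : Fin T.n) (p₀ p₁ : ℝ[X]) :
    (T.hatPoly i i.castSucc * p₀ + T.hatPoly i i.succ * p₁).eval (T.x i.succ) =
      p₁.eval (T.x i.succ) := by
  rw [eval_add, eval_mul, eval_mul, eval_hatPoly_castSucc_succ, T.eval_hatPoly_self (Or.inr rfl)]
  ring

/-- The reconstruction agrees with the ultra-weak solution at all vertices. -/
theorem eval_eq_of_isPrimitive (hab : a < b) (hβ : β ≠ 0) (horth : T.HatOrthogonal β f uh)
    {U : ℝ → ℝ} (hU : IsPrimitive a b U (fun t => f t / β)) (hUe : ∀ e ∈ inflow a b β, U e = 0)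
    {p₀ p₁ : Fin T.n → ℝ[X]} (h₀ : ∀ i, T.SolvesOn β f uh k i i.castSucc (p₀ i))
    (h₁ : ∀ i, T.SolvesOn β f uh k i i.succ (p₁ i)) (i : Fin T.n) :
    U (T.x i.castSucc) = (p₀ i).eval (T.x i.castSucc) ∧
      U (T.x i.succ) = (p₁ i).eval (T.x i.succ) := by
  set δ : Fin T.n → ℝ := fun i => U (T.x i.castSucc) - (p₀ i).eval (T.x i.castSucc) with hδ
  -- The error at the left end of an element equals that at its right end: `β s_h' = Πf` has the
  -- same mean as `f`, so `U` and `s_h` have equal increments.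
  have hδ' : ∀ i, δ i = U (T.x i.succ) - (p₁ i).eval (T.x i.succ) := by
    intro i
    obtain ⟨r, hr, -, hfr⟩ := T.exists_starProjection_eq f k i
    have e1 := (h₀ i).derivative_eq (h₁ i) hr hfr
    have e2 := hfr 1 (by simp)
    simp only [eval_one, mul_one] at e2
    have hle := (T.x_castSucc_lt_succ i).le
    have e3 := (isPrimitive_elem hU i).2 _ ⟨hle, le_rfl⟩
    rw [integral_eq_setIntegral_Ioo hle, integral_div, ← elem, e2, ← e1] at e3
    simp only [eval_mul, eval_C] at e3
    rw [integral_const_mul, integral_elem_derivative, eval_succ, eval_castSucc,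
      mul_div_cancel_left₀ _ hβ] at e3
    rw [e3]
    ring
  -- Continuity of the local solutions at interior vertices carries the error from one element to
  -- the next.
  have hconst := eq_of_forall_succ_eq_castSucc (δ := δ) fun i i' hii' => by
    rw [hδ' i, hδ, SolvesOn.eval_eq_eval hβ horth rfl hii' (h₁ i) (hii' ▸ h₀ i'), hii']
  obtain ⟨i₀, j, hj, hi₀⟩ := T.exists_mem_star_inflow hab hβ
  -- The inflow vertex may be the left or the right end of its element, depending on the sign of
  -- `β`.
  have hzero : δ i₀ = 0 := by
    rcases hi₀ with rfl | rfl
    · rw [hδ]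
      simp only
      rw [hUe _ hj, (h₀ i₀).eval_eq_zero hβ horth hj (Or.inl rfl), sub_zero]
    · rw [hδ', hUe _ hj, (h₁ i₀).eval_eq_zero hβ horth hj (Or.inr rfl), sub_zero]
  have hi := (hconst i i₀).trans hzero
  exact ⟨sub_eq_zero.mp hi, sub_eq_zero.mp ((hδ' i).symm.trans hi)⟩

theorem reconstruction_ae_eq {s : (j : Fin (T.n + 1)) → L2 (T.patch j)} {i : Fin T.n}
    {p₀ p₁ : ℝ[X]} (h₀ : s i.castSucc =ᵐ[volume.restrict (T.elem i)] fun t => p₀.eval t)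
    (h₁ : s i.succ =ᵐ[volume.restrict (T.elem i)] fun t => p₁.eval t) :
    T.reconstruction s =ᵐ[volume.restrict (T.elem i)]
      fun t => (T.hatPoly i i.castSucc * p₀ + T.hatPoly i i.succ * p₁).eval t := by
  filter_upwards [h₀, h₁, ae_restrict_mem (T.measurableSet_elem i)] with t h2 h3 ht
  rw [reconstruction, Finset.sum_eq_add i.castSucc i.succ Fin.castSucc_lt_succ.ne _ (by simp)
    (by simp), h2, h3, T.hat_eq_eval ht, T.hat_eq_eval ht, eval_add, eval_mul, eval_mul]
  intro j _ hj
  rw [T.hat_eq_eval ht, hatPoly_of_notMem, eval_zero, zero_mul]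
  rintro (h | h)
  · exact hj.1 h
  · exact hj.2 h

/-- The error of the reconstruction on an element is bounded by the oscillation of `f`. -/
theorem normOn_sub_reconstruction_le (hab : a < b) (hβ : β ≠ 0) (horth : T.HatOrthogonal β f uh)
    {u : L2 (Ioo a b)} (hu : IsUltraWeakSolution a b β f u)
    {s : (j : Fin (T.n + 1)) → L2 (T.patch j)} (hs : ∀ j, T.IsLocalSolution β f uh k j (s j))
    (i : Fin T.n) :
    MemLp (T.reconstruction s) 2 (volume.restrict (T.elem i)) ∧
    normOn (T.elem i) (fun t => u t - T.reconstruction s t) ≤ T.h i / (Real.pi * |β|) *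
      normOn (T.elem i) (f - (T.polySpace k).starProjection f : L2 (Ioo a b)) := by
  obtain ⟨U, hU, hUe, huU⟩ := hu.exists_isPrimitive hab hβ
  choose p₀ h₀ hs₀ using fun i : Fin T.n => (hs i.castSucc).exists_solvesOn (i := i) (Or.inl rfl)
  choose p₁ h₁ hs₁ using fun i : Fin T.n => (hs i.succ).exists_solvesOn (i := i) (Or.inr rfl)
  obtain ⟨hl, hr⟩ := eval_eq_of_isPrimitive hab hβ horth hU hUe h₀ h₁ i
  obtain ⟨r, hrk, hpr, hfr⟩ := T.exists_starProjection_eq f k i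
  have hder := (h₀ i).derivative_eq (h₁ i) hrk hfr
  have hrec := reconstruction_ae_eq (hs₀ i) (hs₁ i)
  set S := T.hatPoly i i.castSucc * p₀ i + T.hatPoly i i.succ * p₁ i with hS
  have hlt := T.x_castSucc_lt_succ i
  have hW := (isPrimitive_elem hU i).sub (isPrimitive_polynomial hlt.le S)
  have hwm : MemLp (fun t => f t / β - (derivative S).eval t) 2 (volume.restrict (T.elem i)) :=
    ((memLp_div f).mono_measure (Measure.restrict_mono (T.elem_subset i) le_rfl)).sub
      (memLp_polynomial _)
  -- `U - s_h` vanishes at both ends of the element, and its derivative is `(f - Πf) / β`.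
  have hwirt := hW.integral_sq_le hlt hwm (by rw [hS, eval_castSucc, hl, sub_self])
    (by rw [hS, eval_succ, hr, sub_self])
  have e1 : normOn (T.elem i) (fun t => u t - T.reconstruction s t) ^ 2 =
      ∫ t in T.elem i, (U t - S.eval t) * (U t - S.eval t) := by
    rw [normOn_sq]
    refine integral_congr_ae ?_
    filter_upwards [hrec, ae_restrict_of_ae_restrict_of_subset (T.elem_subset i) huU] with t h2 h3
    rw [h2, h3]
  have e2 : ∫ t in T.elem i, (f t / β - (derivative S).eval t) * (f t / β - (derivative S).eval t) =
      |β|⁻¹ ^ 2 *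
        normOn (T.elem i) (f - (T.polySpace k).starProjection f : L2 (Ioo a b)) ^ 2 := by
    rw [normOn_sq, ← integral_const_mul]
    refine integral_congr_ae ?_
    filter_upwards [hpr, ae_restrict_of_ae_restrict_of_subset (T.elem_subset i)
      (Lp.coeFn_sub f ((T.polySpace k).starProjection f))] with t h2 h3
    rw [h3, Pi.sub_apply, h2, ← hder, inv_pow, sq_abs, eval_mul, eval_C]
    field_simp
  refine ⟨(memLp_congr_ae hrec).mpr (memLp_polynomial S), ?_⟩
  refine le_of_sq_le_sq ?_ (mul_nonneg (div_nonneg (T.h_pos i).le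
    (mul_nonneg Real.pi_pos.le (abs_nonneg β))) (normOn_nonneg _ _))
  rw [← elem, e2] at hwirt
  rw [e1]
  refine hwirt.trans (le_of_eq ?_)
  rw [Mesh.h]
  field_simp

theorem norm_sub_le_estimator (hab : a < b) (hβ : β ≠ 0) (horth : T.HatOrthogonal β f uh)
    {u : L2 (Ioo a b)} (hu : IsUltraWeakSolution a b β f u)
    {s : (j : Fin (T.n + 1)) → L2 (T.patch j)} (hs : ∀ j, T.IsLocalSolution β f uh k j (s j)) :
    ‖u - uh‖ ≤ Real.sqrt (∑ i : Fin T.n,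
      (normOn (T.elem i) (fun t => uh t - T.reconstruction s t) +
        T.h i / (Real.pi * |β|) *
          normOn (T.elem i) (f - (T.polySpace k).starProjection f : L2 (Ioo a b))) ^ 2) := by
  rw [T.norm_eq_sqrt_sum]
  refine Real.sqrt_le_sqrt (Finset.sum_le_sum fun i _ => pow_le_pow_left₀ (normOn_nonneg _ _) ?_ 2)
  obtain ⟨hm, hle⟩ := normOn_sub_reconstruction_le hab hβ horth hu hs i
  -- Triangle inequality through the reconstruction: `u - uh = (u - s_h) - (uh - s_h)`.
  have h1 := normOn_sub_le ((T.memLp_elem u i).sub hm) ((T.memLp_elem uh i).sub hm)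
  have h2 : normOn (T.elem i) (u - uh : L2 (Ioo a b)) = normOn (T.elem i) fun t =>
      (⇑u - T.reconstruction s) t - (⇑uh - T.reconstruction s) t := by
    refine normOn_congr ?_
    filter_upwards [ae_restrict_of_ae_restrict_of_subset (T.elem_subset i)
      (Lp.coeFn_sub u uh)] with t h3
    rw [h3]
    simp
  rw [h2, add_comm]
  exact h1.trans (add_le_add_left hle _)

end Mesh

end Advection1D

end

open Advection1D
theorem theorem6p1 {a b : ℝ} (hab : a < b) (T : Mesh a b) {β : ℝ} (hβ : β ≠ 0) (k : ℕ)
    (f uh : L2 (Ioo a b)) (horth : T.HatOrthogonal β f uh) :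
    (∃! u : L2 (Ioo a b), IsUltraWeakSolution a b β f u) ∧
    (∃! s : (j : Fin (T.n + 1)) → L2 (T.patch j), ∀ j, T.IsLocalSolution β f uh k j (s j)) ∧
    ∀ u : L2 (Ioo a b), IsUltraWeakSolution a b β f u →
      ∀ s : (j : Fin (T.n + 1)) → L2 (T.patch j), (∀ j, T.IsLocalSolution β f uh k j (s j)) →
        ‖u - uh‖ ≤ Real.sqrt (∑ i : Fin T.n,
          (normOn (T.elem i) (fun t => uh t - T.reconstruction s t) +
            T.h i / (Real.pi * |β|) *
              normOn (T.elem i) (f - (T.polySpace k).starProjection f : L2 (Ioo a b))) ^ 2) := by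
  refine ⟨existsUnique_isUltraWeakSolution hab hβ f, ?_,
    fun u hu s hs => Mesh.norm_sub_le_estimator hab hβ horth hu hs⟩
  choose s hs using fun j => Mesh.exists_isLocalSolution hab hβ horth k j
  exact ⟨s, hs, fun s' hs' => funext fun j => (hs' j).unique hβ (hs j)⟩
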